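/- Schemes. The input is a simple graph $G$ on the vertex set $[n]$, $n\ge 1$, given as a turnstile stream $\sigma$ of tokens $(a,b,\Delta)$ with $a\neq b$ in $[n]$ and $\Delta\in\mathbb Z$; each token adds $\Delta$ to the multiplicity of $\{a,b\}$, and at the end of the stream every multiplicity is $0$ or $1$. A Verifier with random coins $R$ reads $\sigma$ once in small memory; then it reads, once, a help message (bit string) from a Prover who knows $\sigma$; then it outputs a number or $\bot$. A scheme for a function $f$ is such a Verifier with perfect completeness (for every $\sigma$ there is a help message $\mathcal H(\sigma)$ for which the output is $f(\sigma)$ with probability $1$) and soundness error at most $1/3$ (for every $\sigma$ and every help message, the output lies outside $\{f(\sigma),\bot\}$ with probability at most $1/3$). It is an $[h,v]$-scheme if $\mathcal H(\sigma)$ has $\tilde O(h)$ bits and Verifier uses $\tilde O(v)$ bits of space on all inputs and help messages; $\tilde O(x)$ means at most $C\,x\,(1+\log n)^{c}$ with absolute constants $C,c$. The bound $h$ may depend on the input. $\textsc{MaxMatching}$ is the function $G\mapsto\alpha'(G)$, the number of edges in a maximum matching of $G$. Theorem. For all positive integers $n,h,v$ with $hv\ge n^2$ and $v\ge n$, there is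 an $[\alpha'(G)+h,\,v]$-scheme for $\textsc{MaxMatching}$ on $n$-vertex graphs; a single algorithm, given $n,h,v$, does this for all $n,h,v$, with the same constants $C,c$. In particular there is an $[\alpha',\,n^2/\alpha']$-scheme in the following sense: a single algorithm, given $n$ and an integer $k$ with $1\le k\le n$, is a $[\max(\alpha'(G),k),\,n^2/k]$-scheme for $\textsc{MaxMatching}$ on all $n$-vertex graphs, with absolute constants $C,c$. On graphs with $\alpha'(G)=k$ its costs are $\tilde O(\alpha'(G))$ and $\tilde O(n^2/\alpha'(G))$. -/

import Mathlib

/-! ### Dynamic graph streams -/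

/-- A token `(a, b, Δ)` of a turnstile graph stream: the integer `Δ` (possibly negative) is added to
the multiplicity of the edge `{a, b}`. -/
abbrev Token : Type := ℕ × ℕ × ℤ

/-- The net multiplicity of the pair `{a, b}` after the whole stream `σ`. -/
def edgeMult (σ : List Token) (a b : ℕ) : ℤ :=
  ((σ.filter fun τ => (τ.1 = a ∧ τ.2.1 = b) ∨ (τ.1 = b ∧ τ.2.1 = a)).map fun τ => τ.2.2).sum

/-- The streams that describe a simple graph on the vertex set `{0, …, n - 1}`: every token concerns
a pair of distinct vertices, and every pair of distinct vertices ends up with multiplicity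
`0` or `1`. Nothing is required of the intermediate multiplicities. -/
def graphStreams (n : ℕ) : Set (List Token) :=
  {σ | (∀ τ ∈ σ, τ.1 < n ∧ τ.2.1 < n ∧ τ.1 ≠ τ.2.1) ∧
    ∀ a < n, ∀ b < n, a ≠ b → edgeMult σ a b = 0 ∨ edgeMult σ a b = 1}

/-- The input graph: the graph that the stream `σ` ends up with. -/
def streamGraph (n : ℕ) (σ : List Token) : SimpleGraph (Fin n) where
  Adj a b := a ≠ b ∧ edgeMult σ a b = 1
  symm := ⟨fun a b h => ⟨h.1.symm, by
    have e : edgeMult σ b a = edgeMult σ a b := by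
      unfold edgeMult; simp only [or_comm]
    rw [e]; exact h.2⟩⟩
  loopless := ⟨fun _ h => h.1 rfl⟩

/-- The size (number of edges) of a maximum matching of a graph. -/
noncomputable def matchingNumber {V : Type*} (G : SimpleGraph V) : ℕ :=
  sSup {k | ∃ M : G.Subgraph, M.IsMatching ∧ M.edgeSet.ncard = k}

/-- The problem MaxMatching: the size of a maximum matching of the input graph. -/
noncomputable def maxMatching (n : ℕ) (σ : List Token) : ℕ :=
  matchingNumber (streamGraph n σ)

/-! ### Schemes -/

/-- A streaming verifier. It is one algorithm for all values of a parameter `i : ι` (which collects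
the size of the input and the tunable parameters), and it is computable jointly in all arguments.
Its whole memory is a bit string. It tosses `coins i` coins, which determine its initial memory; the
coins are not available later unless they are kept in memory. It then processes the input token by
token, then the help message bit by bit, and then gives an output from its memory, where `none` is
the output `⊥` (reject). -/
structure Verifier (ι : Type) [Primcodable ι] where
  coins : ι → ℕ
  start : ι → List Bool → List Bool
  read : ι → List Bool → Token → List Bool
  readHelp : ι → List Bool → Bool → List Bool
  output : ι → List Bool → Option ℕ
  coins_computable : Computable coins
  start_computable : Computable fun x : ι × List Bool => start x.1 x.2
  read_computable : Computable fun x : ι × List Bool × Token => read x.1 x.2.1 x.2.2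
  readHelp_computable : Computable fun x : ι × List Bool × Bool => readHelp x.1 x.2.1 x.2.2
  output_computable : Computable fun x : ι × List Bool => output x.1 x.2

namespace Verifier

variable {ι : Type} [Primcodable ι] (A : Verifier ι) (i : ι)

/-- The memory after the (part of the) input stream `σ`, with coin tosses `R`. -/
def memory (R : Fin (A.coins i) → Bool) (σ : List Token) : List Bool :=
  σ.foldl (A.read i) (A.start i (List.ofFn R))

/-- The memory after the input stream `σ` and the (part of the) help message `H`. -/
def memoryHelp (R : Fin (A.coins i) → Bool) (σ : List Token) (H : List Bool) : List Bool :=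
  H.foldl (A.readHelp i) (A.memory i R σ)

/-- The output on input stream `σ` and help message `H`. -/
def out (R : Fin (A.coins i) → Bool) (σ : List Token) (H : List Bool) : Option ℕ :=
  A.output i (A.memoryHelp i R σ H)

open Classical in
/-- The probability, over uniform and independent coin tosses, of the event `E`. -/
noncomputable def prob (E : (Fin (A.coins i) → Bool) → Prop) : ℝ :=
  ((Finset.univ.filter E).card : ℝ) / 2 ^ A.coins i

/-- At the parameter `i`, the verifier gives a scheme for the function `f` on the set `S` of inputs,
with perfect completeness and soundness error at most `1/3`. On every input `σ ∈ S` some help message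
of at most `hcost σ` bits is accepted. The coins and the memory take at most `vcost` bits at all times,
against all inputs and all help messages (the memory bound is for all help messages, hence
for all initial parts of one). -/
structure IsScheme (S : Set (List Token)) (f : List Token → ℕ) (hcost : List Token → ℝ)
    (vcost : ℝ) : Prop where
  coins_le : (A.coins i : ℝ) ≤ vcost
  memory_le : ∀ σ ∈ S, ∀ σ', σ' <+: σ → ∀ R, ((A.memory i R σ').length : ℝ) ≤ vcost
  memoryHelp_le : ∀ σ ∈ S, ∀ R H, ((A.memoryHelp i R σ H).length : ℝ) ≤ vcost
  complete : ∀ σ ∈ S, ∃ H : List Bool, (H.length : ℝ) ≤ hcost σ ∧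
    A.prob i (fun R => A.out i R σ H = some (f σ)) = 1
  sound : ∀ σ ∈ S, ∀ H : List Bool,
    A.prob i (fun R => A.out i R σ H ≠ some (f σ) ∧ A.out i R σ H ≠ none) ≤ 1 / 3

end Verifier

/-- `soft C c n x` is `C · x · (1 + log n)^c`, a bound that is `Õ(x)` when `C` and `c` are constants. -/
noncomputable def soft (C c n : ℕ) (x : ℝ) : ℝ := C * x * (1 + Real.log n) ^ c

/-! ### Closure properties of primitive recursive functions, in pointwise form -/

attribute [fun_prop] Primrec

namespace Primrec

variable {α β γ : Type*} [Primcodable α] [Primcodable β] [Primcodable γ]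

@[fun_prop] theorem fun_id : Primrec (fun a : α => a) := Primrec.id

@[fun_prop] theorem fun_const (c : β) : Primrec (fun _ : α => c) := Primrec.const c

@[fun_prop] theorem fun_comp {f : β → γ} {g : α → β} (hf : Primrec f) (hg : Primrec g) :
    Primrec (fun a => f (g a)) := hf.comp hg

@[fun_prop] theorem fun_fst : Primrec (fun a : α × β => a.1) := Primrec.fst

@[fun_prop] theorem fun_snd : Primrec (fun a : α × β => a.2) := Primrec.snd

@[fun_prop] theorem fun_mk {f : α → β} {g : α → γ} (hf : Primrec f) (hg : Primrec g) :
    Primrec (fun a => (f a, g a)) := hf.pair hg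

@[fun_prop] theorem fun_some {f : α → β} (hf : Primrec f) : Primrec (fun a => some (f a)) :=
  Primrec.option_some.comp hf

@[fun_prop] theorem fun_add {f g : α → ℕ} (hf : Primrec f) (hg : Primrec g) :
    Primrec (fun a => f a + g a) := Primrec.nat_add.comp hf hg

@[fun_prop] theorem fun_mul {f g : α → ℕ} (hf : Primrec f) (hg : Primrec g) :
    Primrec (fun a => f a * g a) := Primrec.nat_mul.comp hf hg

@[fun_prop] theorem fun_sub {f g : α → ℕ} (hf : Primrec f) (hg : Primrec g) :
    Primrec (fun a => f a - g a) := Primrec.nat_sub.comp hf hg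

@[fun_prop] theorem fun_div {f g : α → ℕ} (hf : Primrec f) (hg : Primrec g) :
    Primrec (fun a => f a / g a) := Primrec.nat_div.comp hf hg

@[fun_prop] theorem fun_mod {f g : α → ℕ} (hf : Primrec f) (hg : Primrec g) :
    Primrec (fun a => f a % g a) := Primrec.nat_mod.comp hf hg

@[fun_prop] theorem fun_pow {f g : α → ℕ} (hf : Primrec f) (hg : Primrec g) :
    Primrec (fun a => f a ^ g a) :=
  Primrec₂.comp (f := fun m n : ℕ => m ^ n) (Primrec₂.unpaired'.1 Nat.Primrec.pow) hf hg

@[fun_prop] theorem fun_sum {k : α → ℕ} {f : α → ℕ → ℕ} (hk : Primrec k)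
    (hf : Primrec (fun x : α × ℕ => f x.1 x.2)) :
    Primrec (fun a => ∑ i ∈ Finset.range (k a), f a i) := by
  have h : Primrec (fun x : α × ℕ × ℕ => x.2.2 + f x.1 x.2.1) :=
    Primrec.nat_add.comp (Primrec.snd.comp Primrec.snd)
      (hf.comp (Primrec.pair Primrec.fst (Primrec.fst.comp Primrec.snd)))
  refine (Primrec.nat_rec' (h := fun a (x : ℕ × ℕ) => x.2 + f a x.1) hk (Primrec.const 0)
    h).of_eq fun a => ?_
  induction k a with
  | zero => simp
  | succ m ih => rw [Finset.sum_range_succ, ← ih]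

@[fun_prop] theorem fun_ite {P : α → Prop} [DecidablePred P] {f g : α → β}
    (hP : Primrec (fun a => decide (P a))) (hf : Primrec f) (hg : Primrec g) :
    Primrec (fun a => if P a then f a else g a) := Primrec.ite hP.primrecPred hf hg

@[fun_prop] theorem decide_eq [DecidableEq β] {f g : α → β} (hf : Primrec f) (hg : Primrec g) :
    Primrec (fun a => decide (f a = g a)) := (Primrec.eq.comp hf hg).decide

@[fun_prop] theorem decide_le {f g : α → ℕ} (hf : Primrec f) (hg : Primrec g) :
    Primrec (fun a => decide (f a ≤ g a)) := (Primrec.nat_le.comp hf hg).decide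

@[fun_prop] theorem decide_lt {f g : α → ℕ} (hf : Primrec f) (hg : Primrec g) :
    Primrec (fun a => decide (f a < g a)) := (Primrec.nat_lt.comp hf hg).decide

@[fun_prop] theorem decide_and {p q : α → Prop} [DecidablePred p] [DecidablePred q]
    (hp : Primrec (fun a => decide (p a))) (hq : Primrec (fun a => decide (q a))) :
    Primrec (fun a => decide (p a ∧ q a)) := (hp.primrecPred.and hq.primrecPred).decide

@[fun_prop] theorem decide_or {p q : α → Prop} [DecidablePred p] [DecidablePred q]
    (hp : Primrec (fun a => decide (p a))) (hq : Primrec (fun a => decide (q a))) :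
    Primrec (fun a => decide (p a ∨ q a)) := (hp.primrecPred.or hq.primrecPred).decide

@[fun_prop] theorem decide_not {p : α → Prop} [DecidablePred p]
    (hp : Primrec (fun a => decide (p a))) : Primrec (fun a => decide (¬ p a)) :=
  hp.primrecPred.not.decide

@[fun_prop] theorem fun_findGreatest {k : α → ℕ} {p : α → ℕ → Prop} [∀ a, DecidablePred (p a)]
    (hk : Primrec k) (hp : Primrec (fun x : α × ℕ => decide (p x.1 x.2))) :
    Primrec (fun a => Nat.findGreatest (p a) (k a)) :=
  Primrec.nat_findGreatest hk (PrimrecPred.primrecRel hp.primrecPred)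

@[fun_prop] theorem fun_getD {l : α → List β} {i : α → ℕ} {d : β} (hl : Primrec l)
    (hi : Primrec i) : Primrec (fun a => (l a).getD (i a) d) := (Primrec.list_getD d).comp hl hi

@[fun_prop] theorem fun_length {l : α → List β} (hl : Primrec l) :
    Primrec (fun a => (l a).length) := Primrec.list_length.comp hl

@[fun_prop] theorem fun_append {l l' : α → List β} (hl : Primrec l) (hl' : Primrec l') :
    Primrec (fun a => l a ++ l' a) := Primrec.list_append.comp hl hl'

@[fun_prop] theorem fun_cons {x : α → β} {l : α → List β} (hx : Primrec x) (hl : Primrec l) :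
    Primrec (fun a => x a :: l a) := Primrec.list_cons.comp hx hl

@[fun_prop] theorem fun_map_range {k : α → ℕ} {f : α → ℕ → β} (hk : Primrec k)
    (hf : Primrec (fun x : α × ℕ => f x.1 x.2)) :
    Primrec (fun a => (List.range (k a)).map (f a)) :=
  Primrec.list_map (Primrec.list_range.comp hk) hf

@[fun_prop] theorem fun_encode {f : α → β} (hf : Primrec f) :
    Primrec (fun a => Encodable.encode (f a)) := Primrec.encode.comp hf

@[fun_prop] theorem decide_prime {f : α → ℕ} (hf : Primrec f) :
    Primrec (fun a => decide (f a).Prime) := by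
  have h : ∀ x : ℕ, x.Prime ↔
      2 ≤ x ∧ ∑ d ∈ Finset.range x, (if 2 ≤ d ∧ x % d = 0 then 1 else 0) = 0 := by
    intro x
    rw [Nat.prime_def_lt']
    refine and_congr_right fun _ => ?_
    rw [Finset.sum_eq_zero_iff]
    constructor
    · intro h d hd
      rw [if_neg]
      rintro ⟨h1, h2⟩
      exact h d h1 (Finset.mem_range.1 hd) (Nat.dvd_of_mod_eq_zero h2)
    · intro h d h1 h2 h3
      have := h d (Finset.mem_range.2 h2)
      rw [if_pos ⟨h1, Nat.mod_eq_zero_of_dvd h3⟩] at this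
      exact one_ne_zero this
  simp only [h]
  fun_prop

end Primrec

/-! ### Bit strings as sequences of words -/

/-- The `j`-th word of width `w` of the bit string `l`, padded with zeros, as a number. -/
def bitWord (w : ℕ) (l : List Bool) (j : ℕ) : ℕ :=
  ∑ i ∈ Finset.range w, if l.getD (j * w + i) false = true then 2 ^ i else 0

/-- The bit string that consists of the words `W 0, …, W (k - 1)` of width `w`. -/
def packWords (w k : ℕ) (W : ℕ → ℕ) : List Bool :=
  (List.range (k * w)).map fun s => decide (W (s / w) / 2 ^ (s % w) % 2 = 1)

/-- The residue of `Δ` modulo `p`. -/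
def residue (p : ℕ) (Δ : ℤ) : ℕ :=
  if Encodable.encode Δ % 2 = 0 then (Encodable.encode Δ / 2) % p
  else p - 1 - (Encodable.encode Δ / 2) % p

/-! ### The verifier for MaxMatching -/

namespace MatchingScheme

/-- The number of coins. -/
def coinCount (n : ℕ) : ℕ := 3 * (Nat.findGreatest (fun j => 2 ^ j ≤ n) n + 1) + 3

/-- The width of a memory word. -/
def width (n : ℕ) : ℕ := coinCount n + 1

/-- The modulus: the largest prime that is at most `2 ^ width n`. -/
def modulus (n : ℕ) : ℕ := Nat.findGreatest Nat.Prime (2 ^ width n)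

/-- The number of rows into which the `n ^ 2` vertex pairs are arranged, with `v` pairs in a row. -/
def rows (n v : ℕ) : ℕ := n * n / v + 1

/-- The number of help words that are kept. -/
def helpWords (n : ℕ) : ℕ := 6 * n + 6

section Checks

variable (n v p r : ℕ) (s H : ℕ → ℕ)

/-- How often the vertex `u` is an endpoint of the claimed matching edges. -/
def endpointCount (u : ℕ) : ℕ := ∑ j ∈ Finset.range (2 * H 0), if H (2 + j) = u then 1 else 0

/-- How often the pair `{a, b}` is a claimed matching edge. -/
def edgeCount (a b : ℕ) : ℕ :=
  ∑ i ∈ Finset.range (H 0),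
    if (H (2 + 2 * i) = a ∧ H (3 + 2 * i) = b) ∨ (H (2 + 2 * i) = b ∧ H (3 + 2 * i) = a)
    then 1 else 0

/-- The sum of the labels that the help message lists for the vertex `u`. -/
def listedLabel (u : ℕ) : ℕ :=
  ∑ i ∈ Finset.range (H 1), if H (2 + 2 * H 0 + 2 * i) = u then H (3 + 2 * H 0 + 2 * i) else 0

/-- The label of the vertex `u`: `0` for the vertices in the barrier. -/
def label (u : ℕ) : ℕ := if listedLabel H u = 0 then u + 1 else (listedLabel H u - 1) % (n + 1)

/-- The weight of a vertex pair. -/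
def weight (a b : ℕ) : ℕ :=
  edgeCount H a b + (n + 1) * if (label n H a ≠ 0 ∧ label n H b ≠ 0) ∧ label n H a ≠ label n H b
    then 1 else 0

/-- The upper bound on the size of a matching given by a labelling of the vertices. -/
def labelBound (L : ℕ → ℕ) : ℕ :=
  (∑ u ∈ Finset.range n, if L u = 0 then 1 else 0) +
    ∑ l ∈ Finset.range n, (∑ u ∈ Finset.range n, if L u = l + 1 then 1 else 0) / 2

/-- The `j`-th coefficient of the polynomial in the help message. -/
def coeffWord (j : ℕ) : ℕ := H (2 + 2 * H 0 + 2 * H 1 + j)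

/-- The checks that do not depend on the coins. -/
def StaticChecks : Prop :=
  ((2 * H 0 ≤ n ∧ (∑ j ∈ Finset.range (2 * H 0), if H (2 + j) < n then 0 else 1) = 0) ∧
    (∑ u ∈ Finset.range n, if endpointCount H u ≤ 1 then 0 else 1) = 0) ∧
    labelBound n (label n H) = H 0 ∧ coeffWord H (rows n v - 1) = H 0

/-- The check of the polynomial in the help message against the sketch at a random point. -/
def PolyCheck : Prop :=
  (∑ j ∈ Finset.range (2 * rows n v), coeffWord H j * r ^ j) % p =
    (∑ a ∈ Finset.range n, ∑ b ∈ Finset.range n,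
      s ((a * n + b) % v) * (weight n H a b * r ^ (rows n v - 1 - (a * n + b) / v))) % p

instance : Decidable (StaticChecks n v H) := by unfold StaticChecks; infer_instance

instance : Decidable (PolyCheck n v p r s H) := by unfold PolyCheck; infer_instance

end Checks

/-- The initial memory: a random number, and a zero sketch. -/
def start (n v : ℕ) (R : List Bool) : List Bool :=
  packWords (width n) (1 + v) fun j => if j = 0 then bitWord (width n) R 0 else 0

/-- The update of the sketch in the memory `m` with a token. -/
def read (n v : ℕ) (m : List Bool) (τ : Token) : List Bool :=
  packWords (width n) (1 + v) fun j =>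
    if j = 1 + (τ.1 * n + τ.2.1) % v then
      (bitWord (width n) m j + residue (modulus n) τ.2.2 *
        bitWord (width n) m 0 ^ ((τ.1 * n + τ.2.1) / v)) % modulus n
    else bitWord (width n) m j

/-- The help message is stored behind the sketch, up to a maximal length. -/
def readHelp (n v : ℕ) (m : List Bool) (b : Bool) : List Bool :=
  if m.length < (1 + v + helpWords n) * width n then m ++ [b] else m

/-- The output: the claimed number, if all checks are passed. -/
def output (n v : ℕ) (m : List Bool) : Option ℕ :=
  if StaticChecks n v (fun j => bitWord (width n) m (1 + v + j)) ∧
      PolyCheck n v (modulus n) (bitWord (width n) m 0) (fun y => bitWord (width n) m (1 + y))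
        (fun j => bitWord (width n) m (1 + v + j))
  then some (bitWord (width n) m (1 + v + 0)) else none

section Primrec

variable {α : Type*} [Primcodable α]

@[fun_prop] theorem primrec_bitWord {w j : α → ℕ} {l : α → List Bool} (hw : Primrec w)
    (hl : Primrec l) (hj : Primrec j) : Primrec (fun a => bitWord (w a) (l a) (j a)) := by
  unfold bitWord; fun_prop

@[fun_prop] theorem primrec_packWords {w k : α → ℕ} {W : α → ℕ → ℕ} (hw : Primrec w)
    (hk : Primrec k) (hW : Primrec (fun x : α × ℕ => W x.1 x.2)) :
    Primrec (fun a => packWords (w a) (k a) (W a)) := by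
  unfold packWords; fun_prop

@[fun_prop] theorem primrec_residue {p : α → ℕ} {Δ : α → ℤ} (hp : Primrec p) (hΔ : Primrec Δ) :
    Primrec (fun a => residue (p a) (Δ a)) := by
  unfold residue; fun_prop

@[fun_prop] theorem primrec_coinCount {n : α → ℕ} (hn : Primrec n) :
    Primrec (fun a => coinCount (n a)) := by
  unfold coinCount; fun_prop

@[fun_prop] theorem primrec_width {n : α → ℕ} (hn : Primrec n) :
    Primrec (fun a => width (n a)) := by
  unfold width; fun_prop

@[fun_prop] theorem primrec_modulus {n : α → ℕ} (hn : Primrec n) :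
    Primrec (fun a => modulus (n a)) := by
  unfold modulus; fun_prop

@[fun_prop] theorem primrec_rows {n v : α → ℕ} (hn : Primrec n) (hv : Primrec v) :
    Primrec (fun a => rows (n a) (v a)) := by
  unfold rows; fun_prop

@[fun_prop] theorem primrec_helpWords {n : α → ℕ} (hn : Primrec n) :
    Primrec (fun a => helpWords (n a)) := by
  unfold helpWords; fun_prop

variable {H s : α → ℕ → ℕ} {n v p r a b u : α → ℕ}

@[fun_prop] theorem primrec_endpointCount (hH : Primrec (fun x : α × ℕ => H x.1 x.2))
    (hu : Primrec u) : Primrec (fun x => endpointCount (H x) (u x)) := by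
  unfold endpointCount; fun_prop

@[fun_prop] theorem primrec_listedLabel (hH : Primrec (fun x : α × ℕ => H x.1 x.2))
    (hu : Primrec u) : Primrec (fun x => listedLabel (H x) (u x)) := by
  unfold listedLabel; fun_prop

@[fun_prop] theorem primrec_label (hn : Primrec n) (hH : Primrec (fun x : α × ℕ => H x.1 x.2))
    (hu : Primrec u) : Primrec (fun x => label (n x) (H x) (u x)) := by
  unfold label; fun_prop

@[fun_prop] theorem primrec_edgeCount (hH : Primrec (fun x : α × ℕ => H x.1 x.2))
    (ha : Primrec a) (hb : Primrec b) : Primrec (fun x => edgeCount (H x) (a x) (b x)) := by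
  unfold edgeCount; fun_prop

@[fun_prop] theorem primrec_weight (hn : Primrec n) (hH : Primrec (fun x : α × ℕ => H x.1 x.2))
    (ha : Primrec a) (hb : Primrec b) : Primrec (fun x => weight (n x) (H x) (a x) (b x)) := by
  unfold weight; fun_prop

@[fun_prop] theorem primrec_labelBound (hn : Primrec n)
    (hs : Primrec (fun x : α × ℕ => s x.1 x.2)) :
    Primrec (fun x => labelBound (n x) (s x)) := by
  unfold labelBound; fun_prop

@[fun_prop] theorem primrec_coeffWord (hH : Primrec (fun x : α × ℕ => H x.1 x.2))
    (hu : Primrec u) : Primrec (fun x => coeffWord (H x) (u x)) := by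
  unfold coeffWord; fun_prop

@[fun_prop] theorem primrec_staticChecks (hn : Primrec n) (hv : Primrec v)
    (hH : Primrec (fun x : α × ℕ => H x.1 x.2)) :
    Primrec (fun x => decide (StaticChecks (n x) (v x) (H x))) := by
  unfold StaticChecks; fun_prop

@[fun_prop] theorem primrec_polyCheck (hn : Primrec n) (hv : Primrec v) (hp : Primrec p)
    (hr : Primrec r) (hs : Primrec (fun x : α × ℕ => s x.1 x.2))
    (hH : Primrec (fun x : α × ℕ => H x.1 x.2)) :
    Primrec (fun x => decide (PolyCheck (n x) (v x) (p x) (r x) (s x) (H x))) := by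
  unfold PolyCheck; fun_prop

end Primrec

section PrimrecVerifier

variable {α : Type*} [Primcodable α] {n v : α → ℕ} {m : α → List Bool}

@[fun_prop] theorem primrec_start (hn : Primrec n) (hv : Primrec v) (hm : Primrec m) :
    Primrec (fun a => start (n a) (v a) (m a)) := by
  unfold start; fun_prop

@[fun_prop] theorem primrec_read {τ : α → Token} (hn : Primrec n) (hv : Primrec v)
    (hm : Primrec m) (hτ : Primrec τ) : Primrec (fun a => read (n a) (v a) (m a) (τ a)) := by
  unfold read; fun_prop

@[fun_prop] theorem primrec_readHelp {b : α → Bool} (hn : Primrec n) (hv : Primrec v)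
    (hm : Primrec m) (hb : Primrec b) :
    Primrec (fun a => readHelp (n a) (v a) (m a) (b a)) := by
  unfold readHelp; fun_prop

@[fun_prop] theorem primrec_output (hn : Primrec n) (hv : Primrec v) (hm : Primrec m) :
    Primrec (fun a => output (n a) (v a) (m a)) := by
  have hw (k : α × ℕ → ℕ) (hk : Primrec k) :
      Primrec fun x : α × ℕ => bitWord (width (n x.1)) (m x.1) (k x) := by fun_prop
  unfold output
  refine Primrec.fun_ite (Primrec.decide_and ?_ ?_) ?_ (Primrec.const _)
  · exact primrec_staticChecks hn hv (hw _ (by fun_prop))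
  · exact primrec_polyCheck hn hv (by fun_prop) (by fun_prop) (hw _ (by fun_prop))
      (hw _ (by fun_prop))
  · fun_prop

end PrimrecVerifier

/-- The verifier for MaxMatching; the numbers `n` and `v` are computed from the parameter. -/
def verifier {ι : Type} [Primcodable ι] (n v : ι → ℕ) (hn : Primrec n) (hv : Primrec v) :
    Verifier ι where
  coins i := coinCount (n i)
  start i := start (n i) (v i)
  read i := read (n i) (v i)
  readHelp i := readHelp (n i) (v i)
  output i := output (n i) (v i)
  coins_computable := (primrec_coinCount hn).to_comp
  start_computable :=
    (primrec_start (hn.comp Primrec.fst) (hv.comp Primrec.fst) Primrec.snd).to_comp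
  read_computable := Primrec.to_comp <|
    primrec_read (hn.comp Primrec.fst) (hv.comp Primrec.fst) (by fun_prop) (by fun_prop)
  readHelp_computable := Primrec.to_comp <|
    primrec_readHelp (hn.comp Primrec.fst) (hv.comp Primrec.fst) (by fun_prop) (by fun_prop)
  output_computable :=
    (primrec_output (hn.comp Primrec.fst) (hv.comp Primrec.fst) Primrec.snd).to_comp

end MatchingScheme

/-! ### Matchings and the Tutte–Berge formula -/

namespace SimpleGraph

variable {V : Type*} {G : SimpleGraph V}

open Classical in
theorem Subgraph.IsMatching.card_filter_mem_edges [Fintype V] {M : G.Subgraph} (hM : M.IsMatching)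
    (F : Finset (Sym2 V)) (hF : ∀ e ∈ F, e ∈ M.edgeSet) :
    (Finset.univ.filter fun u => ∃ e ∈ F, u ∈ e).card = 2 * F.card := by
  have h : (Finset.univ.filter fun u => ∃ e ∈ F, u ∈ e) =
      F.biUnion fun e => Finset.univ.filter fun u => u ∈ e := by
    ext u; simp
  rw [h, Finset.card_biUnion]
  · rw [Finset.sum_const_nat (m := 2), mul_comm]
    intro e he
    induction e using Sym2.ind with
    | _ x y =>
      have hxy : x ≠ y := (M.adj_sub (hF _ he)).ne
      rw [← Finset.card_pair hxy]
      congr 1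
      ext u; simp
  · intro e he e' he' hne
    rw [Function.onFun, Finset.disjoint_left]
    intro u hu hu'
    rw [Finset.mem_filter] at hu hu'
    obtain ⟨x, rfl⟩ := hu.2
    obtain ⟨y, rfl⟩ := hu'.2
    exact hne (congrArg (fun z => s(u, z)) (hM.eq_of_adj_left (hF _ he) (hF _ he')))

theorem Subgraph.IsMatching.ncard_verts [Finite V] {M : G.Subgraph} (hM : M.IsMatching) :
    M.verts.ncard = 2 * M.edgeSet.ncard := by
  classical
  have := Fintype.ofFinite V
  rw [Set.ncard_eq_toFinset_card' M.edgeSet,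
    ← hM.card_filter_mem_edges M.edgeSet.toFinset (fun e he => by simpa using he),
    ← Set.ncard_coe_finset]
  congr 1
  rw [hM.verts_eq_biUnion_edgeSet]
  ext u; simp

theorem matchingNumber_bddAbove [Finite V] :
    BddAbove {k | ∃ M : G.Subgraph, M.IsMatching ∧ M.edgeSet.ncard = k} := by
  refine ⟨Nat.card V, ?_⟩
  rintro k ⟨M, hM, rfl⟩
  have h := Set.ncard_le_card M.verts
  rw [hM.ncard_verts] at h
  omega

theorem Subgraph.IsMatching.ncard_le_matchingNumber [Finite V] {M : G.Subgraph}
    (hM : M.IsMatching) : M.edgeSet.ncard ≤ matchingNumber G :=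
  le_csSup matchingNumber_bddAbove ⟨M, hM, rfl⟩

theorem exists_isMatching_ncard_eq [Finite V] :
    ∃ M : G.Subgraph, M.IsMatching ∧ M.edgeSet.ncard = matchingNumber G :=
  Nat.sSup_mem (s := {k | ∃ M : G.Subgraph, M.IsMatching ∧ M.edgeSet.ncard = k})
    ⟨_, ⊥, by intro v hv; simp at hv, rfl⟩ matchingNumber_bddAbove

open Classical in
/-- A matching given as an involution. -/
theorem card_filter_ne_le_matchingNumber [Fintype V] (f : V → V) (hf : ∀ u, f (f u) = u)
    (hadj : ∀ u, f u ≠ u → G.Adj u (f u)) :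
    (Finset.univ.filter fun u => f u ≠ u).card ≤ 2 * matchingNumber G := by
  let M : G.Subgraph :=
    { verts := {u | f u ≠ u}
      Adj := fun u w => f u = w ∧ f u ≠ u
      adj_sub := by rintro u w ⟨rfl, h⟩; exact hadj u h
      edge_vert := fun h => h.2
      symm := ⟨by rintro u w ⟨rfl, h⟩; exact ⟨hf u, by rw [hf]; exact h.symm⟩⟩ }
  have hM : M.IsMatching := by
    intro u hu
    exact ⟨f u, ⟨rfl, hu⟩, fun w hw => hw.1.symm⟩
  have h := hM.ncard_le_matchingNumber
  have h2 := hM.ncard_verts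
  have h3 : M.verts.ncard = (Finset.univ.filter fun u => f u ≠ u).card := by
    rw [← Set.ncard_coe_finset]; congr 1; ext u; simp [M]
  omega

/-- A matching given by enumerating the end vertices of its edges. -/
theorem le_matchingNumber_of_injective [Finite V] {m : ℕ} (x y : Fin m → V)
    (hadj : ∀ i, G.Adj (x i) (y i)) (hinj : Function.Injective (Sum.elim x y)) :
    m ≤ matchingNumber G := by
  classical
  have := Fintype.ofFinite V
  let M : G.Subgraph := ⨆ i, G.subgraphOfAdj (hadj i)
  have hM : M.IsMatching := by
    refine Subgraph.IsMatching.iSup (fun i => .subgraphOfAdj _) fun i j hij => ?_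
    refine Set.disjoint_left.2 fun u hu hu' => ?_
    replace hu := (Subgraph.support_subset_verts _) hu
    replace hu' := (Subgraph.support_subset_verts _) hu'
    simp only [subgraphOfAdj_verts, Set.mem_insert_iff, Set.mem_singleton_iff] at hu hu'
    rcases hu with rfl | rfl <;> rcases hu' with h | h
    · exact hij (Sum.inl_injective (@hinj (.inl i) (.inl j) h))
    · exact Sum.inl_ne_inr (@hinj (.inl i) (.inr j) h)
    · exact Sum.inr_ne_inl (@hinj (.inr i) (.inl j) h)
    · exact hij (Sum.inr_injective (@hinj (.inr i) (.inr j) h))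
  have h := hM.ncard_le_matchingNumber
  have h2 := hM.ncard_verts
  have h3 : M.verts = Set.range (Sum.elim x y) := by
    ext u
    simp only [M, Subgraph.verts_iSup, Set.mem_iUnion, subgraphOfAdj_verts, Set.mem_insert_iff,
      Set.mem_singleton_iff, Set.mem_range, Sum.exists, Sum.elim_inl, Sum.elim_inr]
    rw [← exists_or]
    simp only [eq_comm]
  rw [h3, ← Nat.card_coe_set_eq, Nat.card_range_of_injective hinj, Nat.card_sum] at h2
  simp only [Nat.card_eq_fintype_card, Fintype.card_fin] at h2
  omega

/-- The easy half of the Tutte–Berge formula, for a labelling of the vertices in which the label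
`0` marks the barrier and the edges outside the barrier join vertices with equal labels. -/
theorem matchingNumber_le_of_label [Fintype V] {N : ℕ} (L : V → ℕ) (hL : ∀ u, L u ≤ N)
    (h : ∀ a b, G.Adj a b → L a ≠ 0 → L b ≠ 0 → L a = L b) :
    matchingNumber G ≤ (Finset.univ.filter fun u => L u = 0).card +
      ∑ l ∈ Finset.range N, (Finset.univ.filter fun u => L u = l + 1).card / 2 := by
  classical
  obtain ⟨M, hM, hcard⟩ := exists_isMatching_ncard_eq (G := G)
  rw [← hcard, Set.ncard_eq_toFinset_card' M.edgeSet]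
  set E := M.edgeSet.toFinset with hE
  have hEM : ∀ e ∈ E, e ∈ M.edgeSet := fun e he => by simpa [hE] using he
  have hsub : E ⊆ (E.filter fun e => ∃ u ∈ e, L u = 0) ∪
      (Finset.range N).biUnion fun l => E.filter fun e => ∀ u ∈ e, L u = l + 1 := by
    intro e he
    by_cases h0 : ∃ u ∈ e, L u = 0
    · exact Finset.mem_union_left _ (Finset.mem_filter.2 ⟨he, h0⟩)
    · refine Finset.mem_union_right _ ?_
      push Not at h0
      induction e using Sym2.ind with
      | _ a b =>
        have ha := h0 a (by simp)
        have hb := h0 b (by simp)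
        have hab := h a b (M.adj_sub (hEM _ he)) ha hb
        have := hL a
        simp only [Finset.mem_biUnion, Finset.mem_range, Finset.mem_filter]
        refine ⟨L a - 1, by omega, he, ?_⟩
        intro u hu
        rcases Sym2.mem_iff.1 hu with rfl | rfl <;> omega
  refine (Finset.card_le_card hsub).trans ((Finset.card_union_le _ _).trans (add_le_add ?_ ?_))
  · have hex : ∀ e ∈ E.filter (fun e => ∃ u ∈ e, L u = 0), ∃ u ∈ e, L u = 0 :=
      fun e he => (Finset.mem_filter.1 he).2
    let f : Sym2 V → V := fun e => if h : ∃ u ∈ e, L u = 0 then h.choose else e.out.1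
    have hf : ∀ e ∈ E.filter (fun e => ∃ u ∈ e, L u = 0), f e ∈ e ∧ L (f e) = 0 := fun e he => by
      simp only [f, dif_pos (hex e he)]
      exact (hex e he).choose_spec
    refine Finset.card_le_card_of_injOn f (fun e he => ?_) ?_
    · simpa using (hf e he).2
    · intro e he e' he' hee
      have h1 := (hf e he).1
      have h2 := (hf e' he').1
      rw [← hee] at h2
      obtain ⟨x, hx⟩ := h1
      obtain ⟨y, hy⟩ := h2
      have h3 := hEM e (Finset.mem_filter.1 he).1
      have h4 := hEM e' (Finset.mem_filter.1 he').1
      rw [hx] at h3; rw [hy] at h4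
      rw [hx, hy]
      exact congrArg (fun z => s(f e, z)) (hM.eq_of_adj_left h3 h4)
  · refine Finset.card_biUnion_le.trans (Finset.sum_le_sum fun l _ => ?_)
    rw [Nat.le_div_iff_mul_le two_pos, mul_comm,
      ← hM.card_filter_mem_edges _ fun e he => hEM e (Finset.mem_filter.1 he).1]
    refine Finset.card_le_card fun u hu => ?_
    simp only [Finset.mem_filter, Finset.mem_univ, true_and] at hu ⊢
    obtain ⟨e, he, hu⟩ := hu
    exact he.2 u hu

/-- The graph `G` together with `d` further vertices that are adjacent to all vertices. -/
def addUniversal (G : SimpleGraph V) (d : ℕ) : SimpleGraph (V ⊕ Fin d) where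
  Adj x y := x ≠ y ∧ ∀ a b, x = Sum.inl a → y = Sum.inl b → G.Adj a b
  symm := ⟨fun _ _ h => ⟨h.1.symm, fun a b ha hb => (h.2 b a hb ha).symm⟩⟩
  loopless := ⟨fun _ h => h.1 rfl⟩

theorem card_le_of_addUniversal_isPerfectMatching [Fintype V] {d : ℕ}
    {M : (addUniversal G d).Subgraph} (hM : M.IsPerfectMatching) :
    Fintype.card V ≤ 2 * matchingNumber G + d := by
  classical
  rw [Subgraph.isPerfectMatching_iff] at hM
  choose g hg hg' using hM
  have hgg : ∀ x, g (g x) = x := fun x => (hg' _ _ (hg x).symm).symm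
  let f : V → V := fun u => Sum.elim id (fun _ => u) (g (Sum.inl u))
  have hfl : ∀ u w, g (Sum.inl u) = Sum.inl w → f u = w := fun u w h => by simp [f, h]
  have hfr : ∀ u i, g (Sum.inl u) = Sum.inr i → f u = u := fun u w h => by simp [f, h]
  have hfne : ∀ u w, g (Sum.inl u) = Sum.inl w → G.Adj u w := fun u w h =>
    (M.adj_sub (hg (Sum.inl u))).2 u w rfl h
  have h1 := card_filter_ne_le_matchingNumber (G := G) f
    (fun u => by
      rcases h : g (Sum.inl u) with w | i
      · rw [hfl u w h, hfl w u (by rw [← h, hgg])]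
      · rw [hfr u i h, hfr u i h])
    (fun u hu => by
      rcases h : g (Sum.inl u) with w | i
      · rw [hfl u w h]; exact hfne u w h
      · exact absurd (hfr u i h) hu)
  have h2 : (Finset.univ.filter fun u => ¬ f u ≠ u).card ≤ (Finset.univ : Finset (Fin d)).card := by
    refine (Finset.card_le_card_of_injOn (fun u => g (Sum.inl u))
      (t := Finset.univ.image Sum.inr) (fun u hu => ?_) ?_).trans Finset.card_image_le
    · simp only [Finset.coe_filter, Finset.mem_univ, true_and, Set.mem_ofPred_eq, not_not] at hu
      rcases h : g (Sum.inl u) with w | i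
      · rw [hfl u w h] at hu
        exact absurd hu (hfne u w h).ne'
      · simp [h]
    · intro u _ w _ h
      have := congrArg g h
      simpa [hgg] using this
  rw [Finset.card_fin] at h2
  have h3 := Finset.card_filter_add_card_filter_not (s := (Finset.univ : Finset V)) (fun u => f u ≠ u)
  rw [Finset.card_univ] at h3
  omega

theorem addUniversal_reachable {d : ℕ} {S : Set (V ⊕ Fin d)} {i : Fin d} (hi : Sum.inr i ∉ S)
    (x : ((⊤ : (addUniversal G d).Subgraph).deleteVerts S).verts) :
    ((⊤ : (addUniversal G d).Subgraph).deleteVerts S).coe.Reachable ⟨Sum.inr i, by simpa using hi⟩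
      x := by
  by_cases h : x = ⟨Sum.inr i, by simpa using hi⟩
  · rw [h]
  · refine Adj.reachable
      (show ((⊤ : (addUniversal G d).Subgraph).deleteVerts S).Adj (Sum.inr i) x.1 from ?_)
    rw [Subgraph.deleteVerts_adj]
    exact ⟨trivial, hi, trivial, x.2.2, fun h' => h (Subtype.ext h'.symm), by rintro a b ⟨⟩⟩

/-- The hard half of the Tutte–Berge formula: a barrier `U` and a choice of representatives of the
classes of a partition of the other vertices, such that no edge joins different classes. -/
theorem exists_barrier [Fintype V] [DecidableEq V] (G : SimpleGraph V) :
    ∃ (U : Finset V) (rep : V → V), (∀ u, u ∉ U → rep u ∉ U ∧ rep (rep u) = rep u) ∧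
      (∀ a b, G.Adj a b → a ∉ U → b ∉ U → rep a = rep b) ∧
      U.card + ∑ l, (Finset.univ.filter fun u => u ∉ U ∧ rep u = l).card / 2 ≤
        matchingNumber G := by
  classical
  set ν := matchingNumber G with hν
  rcases isEmpty_or_nonempty V with hV | ⟨⟨v₀⟩⟩
  · exact ⟨∅, id, by simp, by simp, by simp⟩
  rcases le_or_gt (Fintype.card V) (2 * ν + 1) with hn | hn
  · refine ⟨∅, fun _ => v₀, by simp, by simp, ?_⟩
    rw [Finset.sum_eq_single v₀ (fun l _ hl => by simp [hl.symm]) (by simp)]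
    simp
    omega
  obtain ⟨d, hd⟩ := Nat.exists_eq_add_of_le hn
  set G' := addUniversal G d with hG'
  have hviol : ∃ S, G'.IsTutteViolator S := by
    by_contra! h
    obtain ⟨M, hM⟩ := SimpleGraph.tutte.2 h
    have := card_le_of_addUniversal_isPerfectMatching hM
    omega
  obtain ⟨S, hS⟩ := hviol
  unfold IsTutteViolator at hS
  set K := ((⊤ : G'.Subgraph).deleteVerts S).coe with hK
  have hverts : ((⊤ : G'.Subgraph).deleteVerts S).verts = Sᶜ := by
    simp [Set.compl_eq_univ_sdiff]
  have hcard : S.ncard + Nat.card ((⊤ : G'.Subgraph).deleteVerts S).verts =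
      Fintype.card V + d := by
    rw [Nat.card_coe_set_eq, hverts, Set.ncard_add_ncard_compl]
    simp
  have hpar := odd_ncard_oddComponents K
  have hinr : ∀ i, Sum.inr i ∈ S := by
    intro i
    by_contra hi
    have hsub : K.oddComponents.ncard ≤ 1 := by
      refine (Set.ncard_le_one_iff (Set.toFinite _)).2 fun {a b} _ _ => ?_
      induction a using ConnectedComponent.ind with
      | _ a =>
      induction b using ConnectedComponent.ind with
      | _ b =>
      exact ConnectedComponent.sound
        ((addUniversal_reachable hi a).symm.trans (addUniversal_reachable hi b))
    have h0 : S.ncard = 0 := by omega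
    have h1 : K.oddComponents.ncard = 1 := by omega
    rw [h1] at hpar
    have := hpar.1 odd_one
    rw [Nat.odd_iff] at this
    omega
  have hodd : S.ncard + 2 ≤ K.oddComponents.ncard := by
    rw [Nat.odd_iff, Nat.odd_iff] at hpar
    omega
  have hmem : ∀ {u : V}, Sum.inl u ∉ S →
      Sum.inl u ∈ ((⊤ : G'.Subgraph).deleteVerts S).verts := fun h => by rw [hverts]; exact h
  have hl : ∀ x : ((⊤ : G'.Subgraph).deleteVerts S).verts, ∃ u : V, x.1 = Sum.inl u := by
    rintro ⟨x | i, hx⟩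
    · exact ⟨x, rfl⟩
    · rw [hverts] at hx
      exact absurd (hinr i) hx
  choose val hval using hl
  have hvalS : ∀ x, Sum.inl (val x) ∉ S := fun x h => by
    rw [← hval] at h
    exact x.2.2 h
  have hval_mk : ∀ x, (⟨Sum.inl (val x), hmem (hvalS x)⟩ :
      ((⊤ : G'.Subgraph).deleteVerts S).verts) = x := fun x => Subtype.ext (hval x).symm
  let U : Finset V := Finset.univ.filter fun u => Sum.inl u ∈ S
  have hU : ∀ u, u ∉ U ↔ Sum.inl u ∉ S := fun u => by simp [U]
  let rep : V → V := fun u =>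
    if h : Sum.inl u ∈ S then u else val (K.connectedComponentMk ⟨Sum.inl u, hmem h⟩).out
  have hrep : ∀ u (h : Sum.inl u ∉ S),
      rep u = val (K.connectedComponentMk ⟨Sum.inl u, hmem h⟩).out := fun u h => dif_neg h
  have hrep_val : ∀ C : K.ConnectedComponent, rep (val C.out) = val C.out := fun C => by
    rw [hrep _ (hvalS _), hval_mk]
    congr 2
    exact Quot.out_eq C
  have hUcard : S.ncard = U.card + d := by
    have h : S = ((U.image Sum.inl ∪ Finset.univ.image Sum.inr : Finset (V ⊕ Fin d)) :
        Set (V ⊕ Fin d)) := by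
      ext x
      rcases x with u | i
      · simp [U]
      · simp [hinr i]
    rw [h, Set.ncard_coe_finset, Finset.card_union_of_disjoint,
      Finset.card_image_of_injective _ Sum.inl_injective,
      Finset.card_image_of_injective _ Sum.inr_injective, Finset.card_univ, Fintype.card_fin]
    rw [Finset.disjoint_left]
    simp
  refine ⟨U, rep, fun u hu => ?_, fun a b hab ha hb => ?_, ?_⟩
  · rw [hU] at hu ⊢
    rw [hrep u hu]
    exact ⟨hvalS _, hrep_val _⟩
  · rw [hU] at ha hb
    rw [hrep a ha, hrep b hb]
    congr 2
    refine ConnectedComponent.sound (Adj.reachable ?_)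
    simp only [hK, Subgraph.coe_adj, Subgraph.deleteVerts_adj, Subgraph.verts_top, Set.mem_univ,
      ha, hb, not_false_eq_true, Subgraph.top_adj, true_and]
    refine ⟨by simpa using hab.ne, fun a' b' h1 h2 => ?_⟩
    cases h1; cases h2; exact hab
  · obtain ⟨s, hs⟩ : ∃ s : V → ℕ,
        ∀ l, (Finset.univ.filter fun u => u ∉ U ∧ rep u = l).card = s l := ⟨_, fun _ => rfl⟩
    simp only [hs]
    have hsum : ∑ l, s l = (Finset.univ.filter fun u => u ∉ U).card := by
      rw [Finset.card_eq_sum_card_fiberwise (f := rep) (t := Finset.univ) (fun _ _ => by simp)]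
      refine Finset.sum_congr rfl fun l _ => ?_
      rw [← hs, Finset.filter_filter]
    have hsum' : U.card + ∑ l, s l = Fintype.card V := by
      have h := Finset.card_filter_add_card_filter_not (s := (Finset.univ : Finset V)) (· ∈ U)
      rw [Finset.filter_mem_eq_inter, Finset.univ_inter, Finset.card_univ] at h
      rw [hsum, h]
    have hsupp : ∀ C : K.ConnectedComponent, s (val C.out) = C.supp.ncard := by
      intro C
      have h : C.supp.image val =
          ((Finset.univ.filter fun u => u ∉ U ∧ rep u = val C.out : Finset V) : Set V) := by
        ext u
        simp only [Set.mem_image, ConnectedComponent.mem_supp_iff, Finset.coe_filter,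
          Finset.mem_univ, true_and, Set.mem_ofPred_eq, hU]
        constructor
        · rintro ⟨x, hx, rfl⟩
          refine ⟨hvalS x, ?_⟩
          rw [hrep _ (hvalS x), hval_mk, hx]
        · rintro ⟨hu, h⟩
          refine ⟨⟨Sum.inl u, hmem hu⟩, ?_, ?_⟩
          · rw [hrep u hu] at h
            have h2 := congrArg (fun w => K.connectedComponentMk w)
              (show (K.connectedComponentMk ⟨Sum.inl u, hmem hu⟩).out = C.out by
                rw [← hval_mk (K.connectedComponentMk ⟨Sum.inl u, hmem hu⟩).out, ← hval_mk C.out]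
                simp only [h])
            rw [← Quot.out_eq C, ← Quot.out_eq (K.connectedComponentMk ⟨Sum.inl u, hmem hu⟩)]
            exact h2
          · exact Sum.inl_injective (hval ⟨Sum.inl u, hmem hu⟩).symm
      rw [← hs, ← Set.ncard_coe_finset, ← h, Set.ncard_image_of_injective]
      intro x y hxy
      rw [← hval_mk x, ← hval_mk y]
      simp only [hxy]
    have hmod : K.oddComponents.ncard ≤ ∑ l, s l % 2 := by
      have : K.oddComponents.ncard ≤ ((Finset.univ.filter fun l => s l % 2 = 1 : Finset V) :
          Set V).ncard := by
        refine Set.ncard_le_ncard_of_injOn (fun C => val C.out) (fun C hC => ?_) ?_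
        · have hC' : Odd C.supp.ncard := hC
          simpa [hsupp, ← Nat.odd_iff] using hC'
        · intro C _ C' _ h
          have h : val C.out = val C'.out := h
          have h2 : C.out = C'.out := by
            rw [← hval_mk C.out, ← hval_mk C'.out]
            simp only [h]
          rw [← Quot.out_eq C, ← Quot.out_eq C']
          exact congrArg _ h2
      refine this.trans ?_
      rw [Set.ncard_coe_finset, Finset.card_filter]
      refine Finset.sum_le_sum fun l _ => ?_
      split_ifs <;> omega
    have hdiv : ∑ l, s l = 2 * ∑ l, s l / 2 + ∑ l, s l % 2 := by
      rw [Finset.mul_sum, ← Finset.sum_add_distrib]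
      exact Finset.sum_congr rfl fun l _ => (Nat.div_add_mod _ _).symm
    omega

theorem card_filter_rep_ne_le [Fintype V] [DecidableEq V] {U : Finset V} {rep : V → V}
    (h : ∀ u, u ∉ U → rep u ∉ U ∧ rep (rep u) = rep u) :
    (Finset.univ.filter fun u => u ∈ U ∨ rep u ≠ u).card ≤
      U.card + 2 * ∑ l, (Finset.univ.filter fun u => u ∉ U ∧ rep u = l).card / 2 := by
  have hsub : (Finset.univ.filter fun u => u ∈ U ∨ rep u ≠ u) ⊆
      U ∪ Finset.univ.filter fun u => u ∉ U ∧ rep u ≠ u := by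
    intro u
    simp only [Finset.mem_filter, Finset.mem_univ, true_and, Finset.mem_union]
    tauto
  refine (Finset.card_le_card hsub).trans ((Finset.card_union_le _ _).trans ?_)
  gcongr
  rw [Finset.card_eq_sum_card_fiberwise (f := rep) (t := Finset.univ) (fun _ _ => by simp),
    Finset.mul_sum]
  refine Finset.sum_le_sum fun l _ => ?_
  rw [Finset.filter_filter]
  rcases Finset.eq_empty_or_nonempty
    (Finset.univ.filter fun u => (u ∉ U ∧ rep u ≠ u) ∧ rep u = l) with h0 | ⟨u, hu⟩
  · rw [h0]; simp
  · simp only [Finset.mem_filter, Finset.mem_univ, true_and] at hu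
    obtain ⟨⟨hu, -⟩, rfl⟩ := hu
    have hlt : (Finset.univ.filter fun w => (w ∉ U ∧ rep w ≠ w) ∧ rep w = rep u) ⊂
        Finset.univ.filter fun w => w ∉ U ∧ rep w = rep u := by
      rw [Finset.ssubset_iff_of_subset]
      · refine ⟨rep u, ?_, ?_⟩
        · simpa using h u hu
        · simp [(h u hu).2]
      · intro w
        simp only [Finset.mem_filter, Finset.mem_univ, true_and]
        tauto
    have := Finset.card_lt_card hlt
    omega

end SimpleGraph

namespace MatchingScheme

open Polynomial

/-! ### Weighted sums over the stream -/

/-- The sum of the token values, weighted by a function of the vertex pair. -/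
def weightedSum (c : ℕ → ℕ → ℕ) (σ : List Token) : ℤ :=
  (σ.map fun τ => τ.2.2 * (c τ.1 τ.2.1 : ℤ)).sum

/-- The tokens of `σ` concern pairs of distinct vertices below `n`. -/
def ValidTokens (n : ℕ) (σ : List Token) : Prop :=
  ∀ τ ∈ σ, τ.1 < n ∧ τ.2.1 < n ∧ τ.1 ≠ τ.2.1

theorem edgeMult_cons (τ : Token) (σ : List Token) (a b : ℕ) :
    edgeMult (τ :: σ) a b =
      (if (τ.1 = a ∧ τ.2.1 = b) ∨ (τ.1 = b ∧ τ.2.1 = a) then τ.2.2 else 0) + edgeMult σ a b := by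
  unfold edgeMult
  rw [List.filter_cons]
  split_ifs with h1 h2 h2 <;> simp_all

theorem edgeMult_comm (σ : List Token) (a b : ℕ) : edgeMult σ a b = edgeMult σ b a := by
  unfold edgeMult; simp only [or_comm]

theorem edgeMult_self {n : ℕ} {σ : List Token} (hσ : ValidTokens n σ) (a : ℕ) :
    edgeMult σ a a = 0 := by
  unfold edgeMult
  rw [List.filter_eq_nil_iff.2, List.map_nil, List.sum_nil]
  intro τ hτ
  have := (hσ τ hτ).2.2
  simp only [decide_eq_true_eq]
  rintro (⟨h1, h2⟩ | ⟨h1, h2⟩) <;> exact this (h1.trans h2.symm)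

theorem sum_sum_ite_pair {n x y : ℕ} (hx : x < n) (hy : y < n) (hxy : x ≠ y) (f : ℕ → ℕ → ℤ) :
    ∑ a ∈ Finset.range n, ∑ b ∈ Finset.range n,
      (if (x = a ∧ y = b) ∨ (x = b ∧ y = a) then f a b else 0) = f x y + f y x := by
  have h : ∀ a b, (if (x = a ∧ y = b) ∨ (x = b ∧ y = a) then f a b else 0) =
      (if x = a then if y = b then f a b else 0 else 0) +
        (if y = a then if x = b then f a b else 0 else 0) := by
    intro a b
    by_cases h1 : x = a <;> by_cases h2 : y = b <;> by_cases h3 : x = b <;> by_cases h4 : y = a <;>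
      simp_all
  simp only [h, Finset.sum_add_distrib]
  congr 1
  · rw [Finset.sum_eq_single x]
    · rw [Finset.sum_eq_single y]
      · simp
      · intro b _ hb; simp [hb.symm]
      · intro h; exact absurd (Finset.mem_range.2 hy) h
    · intro a _ ha; simp [ha.symm]
    · intro h; exact absurd (Finset.mem_range.2 hx) h
  · rw [Finset.sum_eq_single y]
    · rw [Finset.sum_eq_single x]
      · simp
      · intro b _ hb; simp [hb.symm]
      · intro h; exact absurd (Finset.mem_range.2 hx) h
    · intro a _ ha; simp [ha.symm]
    · intro h; exact absurd (Finset.mem_range.2 hy) h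

theorem two_mul_weightedSum {n : ℕ} {c : ℕ → ℕ → ℕ} (hc : ∀ a b, c a b = c b a) {σ : List Token}
    (hσ : ValidTokens n σ) :
    2 * weightedSum c σ =
      ∑ a ∈ Finset.range n, ∑ b ∈ Finset.range n, (c a b : ℤ) * edgeMult σ a b := by
  induction σ with
  | nil => simp [weightedSum, edgeMult]
  | cons τ σ ih =>
    have h1 := ih fun τ' h => hσ τ' (List.mem_cons_of_mem _ h)
    obtain ⟨hx, hy, hxy⟩ := hσ τ List.mem_cons_self
    have h2 := sum_sum_ite_pair hx hy hxy fun a b => (c a b : ℤ) * τ.2.2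
    simp only [edgeMult_cons, mul_add, Finset.sum_add_distrib, mul_ite, mul_zero]
    rw [h2, ← h1, hc τ.2.1 τ.1]
    simp only [weightedSum, List.map_cons, List.sum_cons]
    ring

/-! ### Soundness of the checks -/

section Static

variable {n v : ℕ} {H : ℕ → ℕ}

theorem label_le {u : ℕ} (hu : u < n) : label n H u ≤ n := by
  unfold label
  split_ifs
  · exact hu
  · exact Nat.lt_succ_iff.1 (Nat.mod_lt _ (Nat.succ_pos _))

theorem edgeCount_comm (a b : ℕ) : edgeCount H a b = edgeCount H b a := by
  unfold edgeCount; simp only [or_comm]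

theorem edgeCount_le (a b : ℕ) : edgeCount H a b ≤ H 0 := by
  unfold edgeCount
  refine (Finset.sum_le_card_nsmul _ _ 1 fun i _ => by split_ifs <;> simp).trans ?_
  simp

theorem weight_comm (a b : ℕ) : weight n H a b = weight n H b a := by
  unfold weight
  rw [edgeCount_comm]
  congr 3
  exact propext ⟨fun h => ⟨h.1.symm, h.2.symm⟩, fun h => ⟨h.1.symm, h.2.symm⟩⟩

theorem StaticChecks.endpoint_lt (h : StaticChecks n v H) {j : ℕ} (hj : j < 2 * H 0) :
    H (2 + j) < n := by
  have := Finset.sum_eq_zero_iff.1 h.1.1.2 j (Finset.mem_range.2 hj)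
  by_contra h'
  simp [h'] at this

theorem StaticChecks.endpoint_injOn (h : StaticChecks n v H) {j k : ℕ} (hj : j < 2 * H 0)
    (hk : k < 2 * H 0) (hjk : H (2 + j) = H (2 + k)) : j = k := by
  by_contra hne
  have h1 := Finset.sum_eq_zero_iff.1 h.1.2 (H (2 + j)) (Finset.mem_range.2 (h.endpoint_lt hj))
  have h2 : endpointCount H (H (2 + j)) ≤ 1 := by
    by_contra h'
    simp [h'] at h1
  unfold endpointCount at h2
  have h3 : ∑ i ∈ ({j, k} : Finset ℕ), (if H (2 + i) = H (2 + j) then 1 else 0) ≤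
      ∑ i ∈ Finset.range (2 * H 0), if H (2 + i) = H (2 + j) then 1 else 0 := by
    refine Finset.sum_le_sum_of_subset fun i hi => ?_
    rcases Finset.mem_insert.1 hi with rfl | hi
    · exact Finset.mem_range.2 hj
    · rw [Finset.mem_singleton.1 hi]; exact Finset.mem_range.2 hk
  rw [Finset.sum_pair hne, hjk] at h3
  rw [hjk] at h2
  simp only [if_true] at h3
  omega

theorem maxMatching_le_labelBound (σ : List Token) (L : ℕ → ℕ) (hL : ∀ u < n, L u ≤ n)
    (h : ∀ a < n, ∀ b < n, a ≠ b → edgeMult σ a b = 1 → L a ≠ 0 → L b ≠ 0 → L a = L b) :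
    maxMatching n σ ≤ labelBound n L := by
  have h1 := SimpleGraph.matchingNumber_le_of_label (G := streamGraph n σ) (N := n)
    (fun u => L u) (fun u => hL u u.2)
    (fun a b hab => h a a.2 b b.2 (fun h => hab.1 (Fin.ext h)) hab.2)
  refine h1.trans_eq ?_
  unfold labelBound
  simp only [Finset.card_filter]
  congr 1
  · exact Fin.sum_univ_eq_sum_range (fun u => if L u = 0 then 1 else 0) n
  · refine Finset.sum_congr rfl fun l _ => ?_
    rw [Fin.sum_univ_eq_sum_range (fun u => if L u = l + 1 then 1 else 0) n]

theorem StaticChecks.le_maxMatching (h : StaticChecks n v H) {σ : List Token}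
    (hm : ∀ i < H 0, edgeMult σ (H (2 + 2 * i)) (H (3 + 2 * i)) = 1) :
    H 0 ≤ maxMatching n σ := by
  have e : ∀ i, 3 + 2 * i = 2 + (2 * i + 1) := fun i => by omega
  refine SimpleGraph.le_matchingNumber_of_injective (G := streamGraph n σ)
    (fun i : Fin (H 0) => ⟨H (2 + 2 * i), h.endpoint_lt (by omega)⟩)
    (fun i : Fin (H 0) => ⟨H (3 + 2 * i), by rw [e]; exact h.endpoint_lt (by omega)⟩) ?_ ?_
  · intro i
    refine ⟨fun h' => ?_, hm i i.2⟩
    have h' := Fin.mk.inj h'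
    rw [e] at h'
    have := h.endpoint_injOn (by omega) (by omega) h'
    omega
  · rintro (i | i) (j | j) hij
    all_goals
      simp only [Sum.elim_inl, Sum.elim_inr, Fin.mk.injEq, e] at hij
      have := h.endpoint_injOn (by omega) (by omega) hij
      first
        | omega
        | (congr 1; apply Fin.ext; omega)

theorem two_mul_weightedSum_weight {σ : List Token} (hσ : ValidTokens n σ)
    (hx : ∀ i < H 0, H (2 + 2 * i) < n) (hy : ∀ i < H 0, H (3 + 2 * i) < n)
    (hxy : ∀ i < H 0, H (2 + 2 * i) ≠ H (3 + 2 * i)) :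
    2 * weightedSum (weight n H) σ = 2 * ∑ i ∈ Finset.range (H 0),
        edgeMult σ (H (2 + 2 * i)) (H (3 + 2 * i)) +
      (n + 1) * ∑ a ∈ Finset.range n, ∑ b ∈ Finset.range n,
        (if (label n H a ≠ 0 ∧ label n H b ≠ 0) ∧ label n H a ≠ label n H b then 1 else 0) *
          edgeMult σ a b := by
  rw [two_mul_weightedSum (c := weight n H) weight_comm hσ]
  simp only [weight, Nat.cast_add, Nat.cast_mul, add_mul, Finset.sum_add_distrib, Nat.cast_ite]
  congr 1
  · have : ∀ a b, (edgeCount H a b : ℤ) * edgeMult σ a b =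
        ∑ i ∈ Finset.range (H 0), if (H (2 + 2 * i) = a ∧ H (3 + 2 * i) = b) ∨
          (H (2 + 2 * i) = b ∧ H (3 + 2 * i) = a) then edgeMult σ a b else 0 := by
      intro a b
      rw [edgeCount, Nat.cast_sum, Finset.sum_mul]
      refine Finset.sum_congr rfl fun i _ => ?_
      split_ifs <;> simp
    simp only [this]
    rw [Finset.sum_congr rfl fun a _ => Finset.sum_comm, Finset.sum_comm, Finset.mul_sum]
    refine Finset.sum_congr rfl fun i hi => ?_
    have hi := Finset.mem_range.1 hi
    rw [sum_sum_ite_pair (hx i hi) (hy i hi) (hxy i hi),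
      edgeMult_comm σ (H (3 + 2 * i))]
    ring
  · simp only [Finset.mul_sum]
    push_cast
    simp only [mul_assoc]

theorem StaticChecks.eq_maxMatching (h : StaticChecks n v H) {σ : List Token}
    (hσ : σ ∈ graphStreams n) {p : ℕ} (hp : n ^ 2 * (2 * n + 1) + n < p)
    (hsum : ((weightedSum (weight n H) σ : ℤ) : ZMod p) = (H 0 : ZMod p)) :
    H 0 = maxMatching n σ := by
  have hval : ValidTokens n σ := hσ.1
  have hμ : ∀ a < n, ∀ b < n, 0 ≤ edgeMult σ a b ∧ edgeMult σ a b ≤ 1 := by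
    intro a ha b hb
    by_cases hab : a = b
    · rw [hab, edgeMult_self hval]; simp
    · rcases hσ.2 a ha b hb hab with h | h <;> rw [h] <;> simp
  have h2 := two_mul_weightedSum (c := weight n H) weight_comm hval
  have hm : 2 * H 0 ≤ n := h.1.1.1
  have e : ∀ i, 3 + 2 * i = 2 + (2 * i + 1) := fun i => by omega
  have hx : ∀ i < H 0, H (2 + 2 * i) < n := fun i hi => h.endpoint_lt (by omega)
  have hy : ∀ i < H 0, H (3 + 2 * i) < n := fun i hi => by rw [e]; exact h.endpoint_lt (by omega)
  have hxy : ∀ i < H 0, H (2 + 2 * i) ≠ H (3 + 2 * i) := fun i hi h' => by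
    rw [e] at h'
    have := h.endpoint_injOn (by omega) (by omega) h'
    omega
  have hnonneg : 0 ≤ weightedSum (weight n H) σ := by
    have : 0 ≤ 2 * weightedSum (weight n H) σ := by
      rw [h2]
      refine Finset.sum_nonneg fun a ha => Finset.sum_nonneg fun b hb => ?_
      exact mul_nonneg (by positivity) (hμ a (Finset.mem_range.1 ha) b (Finset.mem_range.1 hb)).1
    omega
  have hlt : weightedSum (weight n H) σ < p := by
    have : 2 * weightedSum (weight n H) σ ≤
        ∑ a ∈ Finset.range n, ∑ b ∈ Finset.range n, (2 * n + 1 : ℤ) := by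
      rw [h2]
      refine Finset.sum_le_sum fun a ha => Finset.sum_le_sum fun b hb => ?_
      have hab := hμ a (Finset.mem_range.1 ha) b (Finset.mem_range.1 hb)
      refine (mul_le_of_le_one_right (by positivity) hab.2).trans ?_
      have h3 := edgeCount_le (H := H) a b
      have : weight n H a b ≤ 2 * n + 1 := by
        unfold weight
        split_ifs <;> omega
      exact_mod_cast this
    simp only [Finset.sum_const, Finset.card_range, nsmul_eq_mul] at this
    have h3 : ((n ^ 2 * (2 * n + 1) + n : ℕ) : ℤ) < p := by exact_mod_cast hp
    push_cast at h3
    nlinarith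
  have hTot : weightedSum (weight n H) σ = H 0 := by
    have h3 : ((weightedSum (weight n H) σ : ℤ) : ZMod p) = ((H 0 : ℤ) : ZMod p) := by
      rw [hsum]; simp
    have h4 := (ZMod.intCast_eq_intCast_iff' _ _ p).1 h3
    rwa [Int.emod_eq_of_lt hnonneg hlt, Int.emod_eq_of_lt (by positivity)] at h4
    have : H 0 < p := by omega
    exact_mod_cast this
  have hsplit := two_mul_weightedSum_weight hval hx hy hxy
  rw [hTot] at hsplit
  have hA : ∑ i ∈ Finset.range (H 0), edgeMult σ (H (2 + 2 * i)) (H (3 + 2 * i)) ≤ H 0 := by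
    refine (Finset.sum_le_card_nsmul _ _ 1 fun i hi => ?_).trans (by simp)
    exact (hμ _ (hx i (Finset.mem_range.1 hi)) _ (hy i (Finset.mem_range.1 hi))).2
  have hA0 : 0 ≤ ∑ i ∈ Finset.range (H 0), edgeMult σ (H (2 + 2 * i)) (H (3 + 2 * i)) :=
    Finset.sum_nonneg fun i hi =>
      (hμ _ (hx i (Finset.mem_range.1 hi)) _ (hy i (Finset.mem_range.1 hi))).1
  have hterm : ∀ a ∈ Finset.range n, ∀ b ∈ Finset.range n, 0 ≤
      (if (label n H a ≠ 0 ∧ label n H b ≠ 0) ∧ label n H a ≠ label n H b then 1 else 0) *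
          edgeMult σ a b := by
    intro a ha b hb
    have := (hμ a (Finset.mem_range.1 ha) b (Finset.mem_range.1 hb)).1
    split_ifs <;> simp [this]
  have hB0 := Finset.sum_nonneg fun a ha => Finset.sum_nonneg (hterm a ha)
  set A := ∑ i ∈ Finset.range (H 0), edgeMult σ (H (2 + 2 * i)) (H (3 + 2 * i)) with hAdef
  set B := ∑ a ∈ Finset.range n, ∑ b ∈ Finset.range n,
        (if (label n H a ≠ 0 ∧ label n H b ≠ 0) ∧ label n H a ≠ label n H b then 1 else 0) *
          edgeMult σ a b with hBdef
  have hm' : (2 * H 0 : ℤ) ≤ n := by exact_mod_cast hm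
  have hB : B = 0 := by
    by_contra hB
    have : 1 ≤ B := by omega
    nlinarith
  have hA' : A = H 0 := by rw [hB] at hsplit; omega
  refine le_antisymm (h.le_maxMatching (σ := σ) fun i hi => ?_) ?_
  · by_contra hne
    have hsum1 : ∑ i ∈ Finset.range (H 0), (1 - edgeMult σ (H (2 + 2 * i)) (H (3 + 2 * i))) = 0 := by
      rw [Finset.sum_sub_distrib, ← hAdef, hA']; simp
    rw [Finset.sum_eq_zero_iff_of_nonneg] at hsum1
    · have := hsum1 i (Finset.mem_range.2 hi)
      omega
    · intro i hi
      have := (hμ _ (hx i (Finset.mem_range.1 hi)) _ (hy i (Finset.mem_range.1 hi))).2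
      omega
  · rw [← h.2.1]
    refine maxMatching_le_labelBound σ _ (fun u hu => label_le hu) fun a ha b hb _ hab h1 h2 => ?_
    by_contra hne
    have h3 := (Finset.sum_eq_zero_iff_of_nonneg fun a ha => Finset.sum_nonneg (hterm a ha)).1 hB
      a (Finset.mem_range.2 ha)
    have h4 := (Finset.sum_eq_zero_iff_of_nonneg (hterm a (Finset.mem_range.2 ha))).1 h3
      b (Finset.mem_range.2 hb)
    rw [if_pos ⟨⟨h1, h2⟩, hne⟩, hab] at h4
    norm_num at h4

end Static

/-! ### The polynomial identity -/

section Poly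

variable (n v p : ℕ)

/-- The polynomial whose value at the random point is the `y`-th entry of the sketch. -/
noncomputable def sketchPoly (σ : List Token) (y : ℕ) : (ZMod p)[X] :=
  (σ.map fun τ => if (τ.1 * n + τ.2.1) % v = y then
    C (τ.2.2 : ZMod p) * X ^ ((τ.1 * n + τ.2.1) / v) else 0).sum

/-- The polynomial that the Prover is supposed to send. -/
noncomputable def checkPoly (c : ℕ → ℕ → ℕ) (σ : List Token) : (ZMod p)[X] :=
  ∑ a ∈ Finset.range n, ∑ b ∈ Finset.range n,
    sketchPoly n v p σ ((a * n + b) % v) *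
      (C (c a b : ZMod p) * X ^ (rows n v - 1 - (a * n + b) / v))

/-- The polynomial with the coefficients given in the help message. -/
noncomputable def helpPoly (H : ℕ → ℕ) : (ZMod p)[X] :=
  ∑ j ∈ Finset.range (2 * rows n v), C (coeffWord H j : ZMod p) * X ^ j

variable {n v p}

theorem rows_pos : 0 < rows n v := Nat.succ_pos _

theorem pair_div_le {a b : ℕ} (ha : a < n) (hb : b < n) : (a * n + b) / v ≤ rows n v - 1 := by
  unfold rows
  refine Nat.div_le_div_right ?_
  nlinarith

theorem checkPoly_cons (c : ℕ → ℕ → ℕ) (τ : Token) (σ : List Token) :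
    checkPoly n v p c (τ :: σ) = (∑ a ∈ Finset.range n, ∑ b ∈ Finset.range n,
      if (τ.1 * n + τ.2.1) % v = (a * n + b) % v then C ((τ.2.2 : ZMod p) * (c a b : ZMod p)) *
        X ^ ((τ.1 * n + τ.2.1) / v + (rows n v - 1 - (a * n + b) / v)) else 0) +
      checkPoly n v p c σ := by
  simp only [checkPoly, sketchPoly, List.map_cons, List.sum_cons, add_mul, Finset.sum_add_distrib]
  congr 1
  refine Finset.sum_congr rfl fun a _ => Finset.sum_congr rfl fun b _ => ?_
  split_ifs
  · rw [C_mul, pow_add]; ring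
  · simp

theorem natDegree_checkPoly_le (c : ℕ → ℕ → ℕ) {σ : List Token} (hσ : ValidTokens n σ) :
    (checkPoly n v p c σ).natDegree ≤ 2 * (rows n v - 1) := by
  induction σ with
  | nil => simp [checkPoly, sketchPoly]
  | cons τ σ ih =>
    obtain ⟨hx, hy, -⟩ := hσ τ List.mem_cons_self
    rw [checkPoly_cons]
    refine natDegree_add_le_of_degree_le ?_ (ih fun τ' h => hσ τ' (List.mem_cons_of_mem _ h))
    refine natDegree_sum_le_of_forall_le _ _ fun a _ => natDegree_sum_le_of_forall_le _ _ fun b _ => ?_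
    split_ifs
    · refine (natDegree_C_mul_X_pow_le _ _).trans ?_
      have := pair_div_le (v := v) hx hy
      generalize (a * n + b) / v = q
      omega
    · simp

theorem coeff_checkPoly (c : ℕ → ℕ → ℕ) {σ : List Token} (hσ : ValidTokens n σ) :
    (checkPoly n v p c σ).coeff (rows n v - 1) = ((weightedSum c σ : ℤ) : ZMod p) := by
  induction σ with
  | nil => simp [checkPoly, sketchPoly, weightedSum]
  | cons τ σ ih =>
    obtain ⟨hx, hy, -⟩ := hσ τ List.mem_cons_self
    rw [checkPoly_cons, coeff_add, ih fun τ' h => hσ τ' (List.mem_cons_of_mem _ h)]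
    simp only [weightedSum, List.map_cons, List.sum_cons, Int.cast_add, Int.cast_mul,
      Int.cast_natCast]
    congr 1
    have key : ∀ a ∈ Finset.range n, ∀ b ∈ Finset.range n,
        (if (τ.1 * n + τ.2.1) % v = (a * n + b) % v then C ((τ.2.2 : ZMod p) * (c a b : ZMod p)) *
          X ^ ((τ.1 * n + τ.2.1) / v + (rows n v - 1 - (a * n + b) / v)) else 0 :
          (ZMod p)[X]).coeff (rows n v - 1) =
        if a = τ.1 then if b = τ.2.1 then (τ.2.2 : ZMod p) * (c τ.1 τ.2.1 : ZMod p) else 0 else 0 := by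
      intro a ha b hb
      have ha := Finset.mem_range.1 ha
      have hb := Finset.mem_range.1 hb
      have h1 := pair_div_le (v := v) hx hy
      have h2 := pair_div_le (v := v) ha hb
      have h0 := rows_pos (n := n) (v := v)
      by_cases hab : a = τ.1 ∧ b = τ.2.1
      · obtain ⟨rfl, rfl⟩ := hab
        simp only [if_true]
        rw [coeff_C_mul, coeff_X_pow, if_pos (by omega), mul_one]
      · have hR : (if a = τ.1 then if b = τ.2.1 then
            (τ.2.2 : ZMod p) * (c τ.1 τ.2.1 : ZMod p) else 0 else 0) = 0 := by
          split_ifs with h h'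
          · exact absurd ⟨h, h'⟩ hab
          · rfl
          · rfl
        rw [hR]
        split_ifs with hmod
        · rw [coeff_C_mul, coeff_X_pow, if_neg, mul_zero]
          intro h3
          have h4 : (τ.1 * n + τ.2.1) / v = (a * n + b) / v := by omega
          have h5 : τ.1 * n + τ.2.1 = a * n + b := by
            rw [← Nat.div_add_mod (τ.1 * n + τ.2.1) v, h4, hmod, Nat.div_add_mod]
          apply hab
          have hn : 0 < n := by omega
          have h6 := congrArg (· / n) h5
          have h7 := congrArg (· % n) h5
          simp only [mul_comm _ n, Nat.mul_add_div hn, Nat.div_eq_of_lt hy, Nat.div_eq_of_lt hb,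
            Nat.mul_add_mod, Nat.mod_eq_of_lt hy, Nat.mod_eq_of_lt hb] at h6 h7
          exact ⟨by omega, h7.symm⟩
        · simp
    simp only [finsetSum_coeff]
    rw [Finset.sum_congr rfl fun a ha => Finset.sum_congr rfl (key a ha)]
    simp [hx, hy]

theorem natDegree_helpPoly_lt (H : ℕ → ℕ) : (helpPoly n v p H).natDegree < 2 * rows n v := by
  have h0 := rows_pos (n := n) (v := v)
  have : (helpPoly n v p H).natDegree ≤ 2 * rows n v - 1 := by
    refine natDegree_sum_le_of_forall_le _ _ fun j hj => (natDegree_C_mul_X_pow_le _ _).trans ?_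
    have := Finset.mem_range.1 hj
    omega
  omega

theorem coeff_helpPoly (H : ℕ → ℕ) {j : ℕ} (hj : j < 2 * rows n v) :
    (helpPoly n v p H).coeff j = (coeffWord H j : ZMod p) := by
  simp [helpPoly, coeff_X_pow, hj]

theorem polyCheck_iff {H s : ℕ → ℕ} {r : ℕ} (hv : 0 < v) {σ : List Token}
    (hs : ∀ y < v, (s y : ZMod p) = (sketchPoly n v p σ y).eval (r : ZMod p)) :
    PolyCheck n v p r s H ↔ (helpPoly n v p H).eval (r : ZMod p) =
      (checkPoly n v p (weight n H) σ).eval (r : ZMod p) := by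
  unfold PolyCheck
  rw [← ZMod.natCast_eq_natCast_iff']
  simp only [helpPoly, checkPoly, eval_finsetSum, eval_mul, eval_C, eval_pow, eval_X]
  push_cast
  refine Eq.congr rfl ?_
  refine Finset.sum_congr rfl fun a _ => Finset.sum_congr rfl fun b _ => ?_
  rw [hs _ (Nat.mod_lt _ hv)]

/-- A wrong polynomial is accepted at few points only. -/
theorem card_le_of_eval_eq [Fact p.Prime] {H : ℕ → ℕ} {σ : List Token} (hσ : ValidTokens n σ)
    (hne : (coeffWord H (rows n v - 1) : ZMod p) ≠ ((weightedSum (weight n H) σ : ℤ) : ZMod p))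
    (A : Finset ℕ) (hA : ∀ r ∈ A, r < p ∧ (helpPoly n v p H).eval (r : ZMod p) =
      (checkPoly n v p (weight n H) σ).eval (r : ZMod p)) :
    A.card ≤ 2 * rows n v := by
  set P := helpPoly n v p H - checkPoly n v p (weight n H) σ with hP
  have hr := rows_pos (n := n) (v := v)
  have hP0 : P ≠ 0 := by
    intro h
    apply hne
    have := congrArg (fun q => q.coeff (rows n v - 1)) h
    simp only [hP, coeff_sub, coeff_zero] at this
    rw [coeff_helpPoly H (by omega), coeff_checkPoly _ hσ] at this
    exact sub_eq_zero.1 this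
  have hdeg : P.natDegree ≤ 2 * rows n v := by
    refine (natDegree_sub_le _ _).trans (max_le (natDegree_helpPoly_lt H).le ?_)
    have := natDegree_checkPoly_le (p := p) (v := v) (weight n H) hσ
    omega
  refine le_trans ?_ ((card_roots' P).trans hdeg)
  refine le_trans ?_ (Multiset.toFinset_card_le P.roots)
  refine Finset.card_le_card_of_injOn (fun r : ℕ => (r : ZMod p)) (fun r hr => ?_) ?_
  · simp only [Finset.mem_coe, Multiset.mem_toFinset]
    rw [mem_roots hP0, IsRoot.def, hP, eval_sub, (hA r hr).2, sub_self]
  · intro r hr r' hr' h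
    have h := (ZMod.natCast_eq_natCast_iff' _ _ p).1 h
    rwa [Nat.mod_eq_of_lt (hA r hr).1, Nat.mod_eq_of_lt (hA r' hr').1] at h

end Poly

end MatchingScheme

/-! ### Reading and writing words -/

theorem sum_bits_lt (b : ℕ → Prop) [DecidablePred b] (w : ℕ) :
    ∑ i ∈ Finset.range w, (if b i then 2 ^ i else 0) < 2 ^ w := by
  induction w with
  | zero => simp
  | succ w ih => rw [Finset.sum_range_succ, pow_succ]; split_ifs <;> omega

theorem sum_bits_injective {b b' : ℕ → Prop} [DecidablePred b] [DecidablePred b'] {w : ℕ}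
    (h : ∑ i ∈ Finset.range w, (if b i then 2 ^ i else 0) =
      ∑ i ∈ Finset.range w, (if b' i then 2 ^ i else 0)) : ∀ i < w, (b i ↔ b' i) := by
  induction w with
  | zero => simp
  | succ w ih =>
    rw [Finset.sum_range_succ, Finset.sum_range_succ] at h
    have h1 := sum_bits_lt b w
    have h2 := sum_bits_lt b' w
    have h3 : (b w ↔ b' w) ∧ ∑ i ∈ Finset.range w, (if b i then 2 ^ i else 0) =
      ∑ i ∈ Finset.range w, (if b' i then 2 ^ i else 0) := by
      by_cases hb : b w <;> by_cases hb' : b' w <;>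
        simp only [hb, hb', if_true, if_false] at h ⊢ <;>
        first
          | exact ⟨trivial, by omega⟩
          | omega
    intro i hi
    rcases Nat.lt_succ_iff_lt_or_eq.1 hi with hi | rfl
    · exact ih h3.2 i hi
    · exact h3.1

theorem sum_bits_eq_mod (x w : ℕ) :
    ∑ i ∈ Finset.range w, (if x / 2 ^ i % 2 = 1 then 2 ^ i else 0) = x % 2 ^ w := by
  induction w with
  | zero => simp [Nat.mod_one]
  | succ w ih =>
    rw [Finset.sum_range_succ, ih, Nat.mod_pow_succ]
    rcases Nat.mod_two_eq_zero_or_one (x / 2 ^ w) with h | h <;> simp [h]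

theorem bitWord_lt (w : ℕ) (l : List Bool) (j : ℕ) : bitWord w l j < 2 ^ w := sum_bits_lt _ w

@[simp] theorem length_packWords (w k : ℕ) (W : ℕ → ℕ) : (packWords w k W).length = k * w := by
  simp [packWords]

theorem bitWord_packWords_append {w k : ℕ} {W : ℕ → ℕ} (l : List Bool) {j : ℕ} (hj : j < k)
    (hW : W j < 2 ^ w) : bitWord w (packWords w k W ++ l) j = W j := by
  rw [← Nat.mod_eq_of_lt hW, ← sum_bits_eq_mod]
  refine Finset.sum_congr rfl fun i hi => ?_
  have hi := Finset.mem_range.1 hi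
  have hlt : j * w + i < k * w := by
    calc j * w + i < (j + 1) * w := by rw [Nat.succ_mul]; omega
      _ ≤ k * w := Nat.mul_le_mul_right _ hj
  rw [List.getD_append _ _ _ _ (by simpa using hlt), List.getD_eq_getElem _ _ (by simpa using hlt)]
  have h1 : (j * w + i) / w = j := by
    rw [mul_comm, Nat.mul_add_div (by omega), Nat.div_eq_of_lt hi, add_zero]
  have h2 : (j * w + i) % w = i := by
    rw [mul_comm, Nat.mul_add_mod, Nat.mod_eq_of_lt hi]
  simp [packWords, h1, h2]

theorem bitWord_packWords_append_add (w k : ℕ) (W : ℕ → ℕ) (l : List Bool) (j : ℕ) :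
    bitWord w (packWords w k W ++ l) (k + j) = bitWord w l j := by
  refine Finset.sum_congr rfl fun i _ => ?_
  rw [List.getD_append_right _ _ _ _ (by rw [length_packWords, add_mul]; omega), length_packWords,
    add_mul, add_assoc, Nat.add_sub_cancel_left]

theorem bitWord_packWords {w k : ℕ} {W : ℕ → ℕ} (hW : ∀ j, W j < 2 ^ w)
    (hk : ∀ j, k ≤ j → W j = 0) (j : ℕ) : bitWord w (packWords w k W) j = W j := by
  rw [← List.append_nil (packWords w k W)]
  rcases lt_or_ge j k with h | h
  · exact bitWord_packWords_append _ h (hW j)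
  · obtain ⟨i, rfl⟩ := Nat.exists_eq_add_of_le h
    rw [bitWord_packWords_append_add, hk _ h]
    simp [bitWord]

theorem natCast_residue {p : ℕ} (hp : 0 < p) (Δ : ℤ) : (residue p Δ : ZMod p) = (Δ : ZMod p) := by
  rcases Δ with k | k
  · have h : Encodable.encode (Int.ofNat k) = 2 * k := rfl
    rw [residue, h, if_pos (by omega)]
    simp
  · have h : Encodable.encode (Int.negSucc k) = 2 * k + 1 := rfl
    have hlt := Nat.mod_lt k hp
    rw [residue, h, if_neg (by omega), show (2 * k + 1) / 2 = k by omega,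
      Nat.cast_sub (by omega), Nat.cast_sub (by omega), Int.cast_negSucc]
    simp
    ring

namespace MatchingScheme

/-! ### The parameters -/

theorem lt_two_pow_findGreatest (n : ℕ) : n < 2 ^ (Nat.findGreatest (fun j => 2 ^ j ≤ n) n + 1) := by
  by_contra! h
  have h1 := Nat.lt_two_pow_self (n := Nat.findGreatest (fun j => 2 ^ j ≤ n) n + 1)
  have := Nat.le_findGreatest (P := fun j => 2 ^ j ≤ n) (h1.le.trans h) h
  omega

theorem pow_le_two_pow_coinCount (n : ℕ) : 8 * (n + 1) ^ 3 ≤ 2 ^ coinCount n := by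
  have h := Nat.pow_le_pow_left (lt_two_pow_findGreatest n) 3
  rw [← pow_mul] at h
  unfold coinCount
  rw [pow_add, mul_comm 3]
  simp only [Nat.succ_eq_add_one] at h
  omega

theorem exists_prime_le_two_pow_width (n : ℕ) :
    ∃ q, q.Prime ∧ 2 ^ coinCount n < q ∧ q ≤ 2 ^ width n := by
  obtain ⟨q, hq, h1, h2⟩ := Nat.exists_prime_lt_and_le_two_mul (2 ^ coinCount n) (by positivity)
  exact ⟨q, hq, h1, by rwa [width, pow_succ']⟩

theorem modulus_prime (n : ℕ) : (modulus n).Prime := by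
  obtain ⟨q, hq, -, h⟩ := exists_prime_le_two_pow_width n
  exact Nat.findGreatest_spec h hq

theorem two_pow_coinCount_lt_modulus (n : ℕ) : 2 ^ coinCount n < modulus n := by
  obtain ⟨q, hq, h1, h⟩ := exists_prime_le_two_pow_width n
  exact h1.trans_le (Nat.le_findGreatest h hq)

theorem modulus_le (n : ℕ) : modulus n ≤ 2 ^ width n := Nat.findGreatest_le _

theorem lt_modulus (n : ℕ) : n ^ 2 * (2 * n + 1) + n < modulus n := by
  have h1 := pow_le_two_pow_coinCount n
  have h2 := two_pow_coinCount_lt_modulus n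
  nlinarith

theorem add_one_lt_two_pow_width (n : ℕ) : n + 1 < 2 ^ width n := by
  have h1 := pow_le_two_pow_coinCount n
  have h2 := two_pow_coinCount_lt_modulus n
  have h3 := modulus_le n
  nlinarith [Nat.zero_le (n ^ 3)]

theorem width_le {n : ℕ} (hn : 1 ≤ n) : (width n : ℝ) ≤ 7 * (1 + Real.log n) := by
  have h1 : 2 ^ Nat.findGreatest (fun j => 2 ^ j ≤ n) n ≤ n :=
    Nat.findGreatest_spec (P := fun j => 2 ^ j ≤ n) (Nat.zero_le n) (by simpa using hn)
  unfold width coinCount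
  generalize Nat.findGreatest (fun j => 2 ^ j ≤ n) n = g at h1
  have h2 : ((2 : ℝ) ^ g) ≤ n := by exact_mod_cast h1
  have h3 := Real.log_le_log (by positivity) h2
  rw [Real.log_pow] at h3
  have h4 := Real.log_two_gt_d9
  have h5 : (0 : ℝ) ≤ g := by positivity
  push_cast
  nlinarith

/-! ### The contents of the memory -/

section Memory

open Polynomial

theorem bitWord_ofFn_lt (n : ℕ) (R : Fin (coinCount n) → Bool) :
    bitWord (width n) (List.ofFn R) 0 < 2 ^ coinCount n := by
  unfold bitWord width
  rw [Finset.sum_range_succ, if_neg, add_zero]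
  · exact sum_bits_lt _ _
  · rw [List.getD_eq_default] <;> simp

theorem bitWord_ofFn_injective (n : ℕ) :
    Function.Injective fun R : Fin (coinCount n) → Bool => bitWord (width n) (List.ofFn R) 0 := by
  intro R R' h
  funext i
  have := sum_bits_injective h i (i.2.trans (Nat.lt_succ_self _))
  simpa [List.getD_eq_getElem?_getD, ← Bool.eq_iff_iff] using this

variable {ι : Type} [Primcodable ι] {n v : ι → ℕ} {hn : Primrec n} {hv : Primrec v} (i : ι)

theorem memory_eq (R : Fin (coinCount (n i)) → Bool) (hv0 : 0 < v i) (σ : List Token) :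
    ∃ W : ℕ → ℕ, (verifier n v hn hv).memory i R σ = packWords (width (n i)) (1 + v i) W ∧
      W 0 = bitWord (width (n i)) (List.ofFn R) 0 ∧ (∀ j < 1 + v i, W j < 2 ^ width (n i)) ∧
      ∀ y < v i, (W (1 + y) : ZMod (modulus (n i))) =
        (sketchPoly (n i) (v i) (modulus (n i)) σ y).eval
          (bitWord (width (n i)) (List.ofFn R) 0 : ZMod (modulus (n i))) := by
  induction σ using List.reverseRecOn with
  | nil =>
    refine ⟨fun j => if j = 0 then bitWord (width (n i)) (List.ofFn R) 0 else 0, rfl, rfl,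
      fun j _ => ?_, fun y _ => ?_⟩
    · beta_reduce
      split_ifs
      · exact bitWord_lt _ _ _
      · positivity
    · simp [sketchPoly]
  | append_singleton σ τ ih =>
    obtain ⟨W, hmem, hW0, hW, hsk⟩ := ih
    have hb : ∀ j < 1 + v i, bitWord (width (n i))
        ((verifier n v hn hv).memory i R σ) j = W j := fun j hj => by
      rw [hmem, ← List.append_nil (packWords _ _ W)]
      exact bitWord_packWords_append _ hj (hW j hj)
    refine ⟨fun j => if j = 1 + (τ.1 * n i + τ.2.1) % v i then
      (bitWord (width (n i)) ((verifier n v hn hv).memory i R σ) j +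
        residue (modulus (n i)) τ.2.2 *
        bitWord (width (n i)) ((verifier n v hn hv).memory i R σ) 0 ^
          ((τ.1 * n i + τ.2.1) / v i)) % modulus (n i)
      else bitWord (width (n i)) ((verifier n v hn hv).memory i R σ) j, ?_, ?_, ?_, ?_⟩
    · unfold Verifier.memory
      rw [List.foldl_append]
      rfl
    · beta_reduce
      rw [if_neg (by omega), hb 0 (by omega), hW0]
    · intro j hj
      beta_reduce
      split_ifs
      · exact (Nat.mod_lt _ (modulus_prime _).pos).trans_le (modulus_le _)
      · exact bitWord_lt _ _ _
    · intro y hy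
      beta_reduce
      rw [hb _ (by omega), hb 0 (by omega), hW0]
      simp only [sketchPoly, List.map_append, List.sum_append, List.map_cons, List.map_nil,
        List.sum_cons, List.sum_nil, add_zero, eval_add]
      rw [← sketchPoly, ← hsk y hy]
      by_cases h : (τ.1 * n i + τ.2.1) % v i = y
      · rw [if_pos (by omega), if_pos h, ZMod.natCast_mod]
        push_cast
        rw [natCast_residue (modulus_prime _).pos]
        simp
      · rw [if_neg (by omega), if_neg h, eval_zero, add_zero]

theorem foldl_readHelp (n v : ℕ) (H m : List Bool)
    (hm : m.length ≤ (1 + v + helpWords n) * width n) :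
    H.foldl (readHelp n v) m = m ++ H.take ((1 + v + helpWords n) * width n - m.length) := by
  induction H generalizing m with
  | nil => simp
  | cons b H ih =>
    rw [List.foldl_cons, readHelp]
    split_ifs with h
    · rw [ih _ (by simp; omega), List.length_append, List.length_singleton,
        show (1 + v + helpWords n) * width n - m.length =
          ((1 + v + helpWords n) * width n - (m.length + 1)) + 1 by omega, List.take_succ_cons]
      simp
    · rw [ih _ hm, show (1 + v + helpWords n) * width n - m.length = 0 by omega]
      simp

theorem memoryHelp_eq (R : Fin (coinCount (n i)) → Bool) (hv0 : 0 < v i) (σ : List Token)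
    (H : List Bool) : (verifier n v hn hv).memoryHelp i R σ H =
      (verifier n v hn hv).memory i R σ ++ H.take (helpWords (n i) * width (n i)) := by
  obtain ⟨W, hmem, -⟩ := memory_eq (hn := hn) (hv := hv) i R hv0 σ
  have hlen : ((verifier n v hn hv).memory i R σ).length = (1 + v i) * width (n i) := by
    rw [hmem, length_packWords]
  refine (foldl_readHelp (n i) (v i) H _ ?_).trans ?_
  · rw [hlen]; exact Nat.mul_le_mul_right _ (by omega)
  · rw [hlen, add_mul, Nat.add_sub_cancel_left]

open Classical in
theorem out_eq (R : Fin (coinCount (n i)) → Bool) (hv0 : 0 < v i) (σ : List Token)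
    (H : List Bool) (K : ℕ → ℕ)
    (hK : ∀ j, bitWord (width (n i)) (H.take (helpWords (n i) * width (n i))) j = K j) :
    (verifier n v hn hv).out i R σ H =
      if StaticChecks (n i) (v i) K ∧
        (helpPoly (n i) (v i) (modulus (n i)) K).eval
          (bitWord (width (n i)) (List.ofFn R) 0 : ZMod (modulus (n i))) =
        (checkPoly (n i) (v i) (modulus (n i)) (weight (n i) K) σ).eval
          (bitWord (width (n i)) (List.ofFn R) 0 : ZMod (modulus (n i)))
      then some (K 0) else none := by
  obtain ⟨W, hmem, hW0, hW, hsk⟩ := memory_eq (hn := hn) (hv := hv) i R hv0 σ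
  have hlow : ∀ j < 1 + v i, bitWord (width (n i)) ((verifier n v hn hv).memoryHelp i R σ H) j =
      W j := fun j hj => by
    rw [memoryHelp_eq i R hv0, hmem]
    exact bitWord_packWords_append _ hj (hW j hj)
  have hhigh : ∀ j, bitWord (width (n i)) ((verifier n v hn hv).memoryHelp i R σ H) (1 + v i + j) =
      K j := fun j => by
    rw [memoryHelp_eq i R hv0, hmem, bitWord_packWords_append_add, hK]
  have hout : (verifier n v hn hv).out i R σ H =
    output (n i) (v i) ((verifier n v hn hv).memoryHelp i R σ H) := rfl
  rw [hout, output]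
  simp only [hhigh, hlow 0 (by omega), hW0]
  refine if_congr (and_congr_right fun _ => ?_) rfl rfl
  refine polyCheck_iff hv0 fun y hy => ?_
  rw [hlow _ (by omega), hsk y hy]

end Memory

end MatchingScheme

theorem SimpleGraph.exists_enum_matching {V : Type*} [Finite V] (G : SimpleGraph V) :
    ∃ x y : Fin (matchingNumber G) → V, (∀ i, G.Adj (x i) (y i)) ∧
      Function.Injective (Sum.elim x y) := by
  obtain ⟨M, hM, hcard⟩ := SimpleGraph.exists_isMatching_ncard_eq (G := G)
  have hfin : Finite M.edgeSet := Set.toFinite _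
  let e := (Finite.equivFinOfCardEq (α := M.edgeSet) hcard).symm
  have he : ∀ i, s((e i).1.out.1, (e i).1.out.2) = (e i).1 := fun i => Quot.out_eq (e i).1
  have hadj : ∀ i, M.Adj (e i).1.out.1 (e i).1.out.2 := fun i => by
    rw [← SimpleGraph.Subgraph.mem_edgeSet, he]
    exact (e i).2
  have huniq : ∀ {i j u}, u ∈ (e i).1 → u ∈ (e j).1 → i = j := by
    intro i j u hi hj
    obtain ⟨a, ha⟩ := hi
    obtain ⟨b, hb⟩ := hj
    have h1 := (e i).2
    have h2 := (e j).2
    rw [ha] at h1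
    rw [hb] at h2
    refine e.injective (Subtype.ext ?_)
    rw [ha, hb]
    exact congrArg (fun z => s(u, z)) (hM.eq_of_adj_left h1 h2)
  have hx : ∀ i, (e i).1.out.1 ∈ (e i).1 := fun i => Sym2.out_fst_mem _
  have hy : ∀ i, (e i).1.out.2 ∈ (e i).1 := fun i => Sym2.out_snd_mem _
  refine ⟨fun i => (e i).1.out.1, fun i => (e i).1.out.2, fun i => M.adj_sub (hadj i), ?_⟩
  rintro (i | i) (j | j) hij
  all_goals simp only [Sum.elim_inl, Sum.elim_inr] at hij
  · rw [huniq (hx i) (hij ▸ hx j)]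
  · obtain rfl := huniq (hx i) (hij ▸ hy j)
    exact absurd hij (M.adj_sub (hadj i)).ne
  · obtain rfl := huniq (hy i) (hij ▸ hx j)
    exact absurd hij (M.adj_sub (hadj i)).ne'
  · rw [huniq (hy i) (hij ▸ hy j)]

theorem Finset.exists_enum (Q : Finset ℕ) : ∃ e : ℕ → ℕ, (∀ i < Q.card, e i ∈ Q) ∧
    ∀ F : ℕ → ℕ, ∑ i ∈ Finset.range Q.card, F (e i) = ∑ u ∈ Q, F u := by
  refine ⟨fun i => if h : i < Q.card then Q.equivFin.symm ⟨i, h⟩ else 0, fun i hi => ?_,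
    fun F => ?_⟩
  · simp [hi]
  · rw [← Fin.sum_univ_eq_sum_range (fun i => F (if h : i < Q.card then Q.equivFin.symm ⟨i, h⟩ else 0))]
    simp only [Fin.is_lt, dif_pos, Fin.eta]
    rw [Equiv.sum_comp Q.equivFin.symm (fun u : Q => F u), Finset.sum_coe_sort]

namespace Verifier

variable {ι : Type} [Primcodable ι] (A : Verifier ι) (i : ι) {E : (Fin (A.coins i) → Bool) → Prop}

theorem prob_eq_one (h : ∀ R, E R) : A.prob i E = 1 := by
  simp [prob, h]

theorem prob_le_third
    (h : ∀ S : Finset (Fin (A.coins i) → Bool), (∀ R ∈ S, E R) → 3 * S.card ≤ 2 ^ A.coins i) :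
    A.prob i E ≤ 1 / 3 := by
  classical
  have h1 := h (Finset.univ.filter E) fun R hR => (Finset.mem_filter.1 hR).2
  have h2 : (3 : ℝ) * (Finset.univ.filter E).card ≤ 2 ^ A.coins i := by exact_mod_cast h1
  unfold prob
  rw [div_le_div_iff₀ (by positivity) (by norm_num), one_mul, mul_comm]
  exact h2

end Verifier

namespace MatchingScheme

open Polynomial

/-! ### The honest help message -/

theorem exists_enum_maxMatching (n : ℕ) (σ : List Token) :
    ∃ e : ℕ → ℕ, (∀ j < 2 * maxMatching n σ, e j < n) ∧
      (∀ j < 2 * maxMatching n σ, ∀ k < 2 * maxMatching n σ, e j = e k → j = k) ∧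
      ∀ i < maxMatching n σ, edgeMult σ (e (2 * i)) (e (2 * i + 1)) = 1 := by
  obtain ⟨x, y, hadj, hinj⟩ := (streamGraph n σ).exists_enum_matching
  have hlt : ∀ j < 2 * maxMatching n σ, j / 2 < matchingNumber (streamGraph n σ) := fun j hj => by
    rw [maxMatching] at hj; omega
  let z : Fin (matchingNumber (streamGraph n σ)) → ℕ → Fin n := fun i j =>
    Sum.elim x y (if j % 2 = 0 then .inl i else .inr i)
  refine ⟨fun j => if h : j / 2 < matchingNumber (streamGraph n σ) then z ⟨j / 2, h⟩ j else 0,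
    fun j hj => ?_, fun j hj k hk hjk => ?_, fun i hi => ?_⟩
  · beta_reduce
    rw [dif_pos (hlt j hj)]
    exact Fin.is_lt _
  · beta_reduce at hjk
    rw [dif_pos (hlt j hj), dif_pos (hlt k hk)] at hjk
    have h := hinj (Fin.ext hjk)
    split_ifs at h
    · have := congrArg Fin.val (Sum.inl_injective h)
      simp only at this
      omega
    · have := congrArg Fin.val (Sum.inr_injective h)
      simp only at this
      omega
  · have h1 : (2 * i) / 2 = i := by omega
    have h2 : (2 * i + 1) / 2 = i := by omega
    have h3 : i < matchingNumber (streamGraph n σ) := hi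
    have h4 : (2 * i + 1) % 2 ≠ 0 := by omega
    simp only [h1, h2, h3, dif_pos, z, Nat.mul_mod_right, if_true, h4, if_false, Sum.elim_inl,
      Sum.elim_inr]
    exact (hadj ⟨i, h3⟩).2

/-- An optimal labelling that differs from the default labelling at few vertices only. -/
theorem exists_label (n : ℕ) (σ : List Token) :
    ∃ L : ℕ → ℕ, (∀ u < n, L u ≤ n) ∧
      (∀ a < n, ∀ b < n, a ≠ b → edgeMult σ a b = 1 → L a ≠ 0 → L b ≠ 0 → L a = L b) ∧
      labelBound n L = maxMatching n σ ∧
      ((Finset.range n).filter fun u => L u ≠ u + 1).card ≤ 2 * maxMatching n σ := by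
  obtain ⟨U, rep, hrep, hadj, hle⟩ := (streamGraph n σ).exists_barrier
  let L : ℕ → ℕ := fun u => if h : u < n then if ⟨u, h⟩ ∈ U then 0 else rep ⟨u, h⟩ + 1 else 0
  have hL : ∀ u : Fin n, L u = if u ∈ U then 0 else (rep u : ℕ) + 1 := fun u => by simp [L]
  have hLn : ∀ u < n, L u ≤ n := fun u hu => by
    rw [hL ⟨u, hu⟩]
    split_ifs
    · omega
    · exact (rep _).is_lt
  have hcross : ∀ a < n, ∀ b < n, a ≠ b → edgeMult σ a b = 1 → L a ≠ 0 → L b ≠ 0 →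
      L a = L b := by
    intro a ha b hb hab h1 hLa hLb
    have h2 : ⟨a, ha⟩ ∉ U := fun h => hLa (by rw [hL ⟨a, ha⟩, if_pos h])
    have h3 : ⟨b, hb⟩ ∉ U := fun h => hLb (by rw [hL ⟨b, hb⟩, if_pos h])
    rw [hL ⟨a, ha⟩, hL ⟨b, hb⟩, if_neg h2, if_neg h3, hadj ⟨a, ha⟩ ⟨b, hb⟩ ⟨fun h => hab (congrArg Fin.val h), h1⟩ h2 h3]
  refine ⟨L, hLn, hcross, le_antisymm ?_ (maxMatching_le_labelBound σ L hLn hcross), ?_⟩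
  · refine le_trans (le_of_eq ?_) hle
    unfold labelBound
    congr 1
    · rw [← Fin.sum_univ_eq_sum_range (fun u => if L u = 0 then 1 else 0), ← Finset.card_filter]
      congr 1
      ext u
      simp [hL]
    · rw [← Fin.sum_univ_eq_sum_range
        (fun l => (∑ u ∈ Finset.range n, if L u = l + 1 then 1 else 0) / 2)]
      refine Finset.sum_congr rfl fun l _ => ?_
      rw [← Fin.sum_univ_eq_sum_range (fun u => if L u = l + 1 then 1 else 0),
        ← Finset.card_filter]
      congr 2
      ext u
      by_cases hu : u ∈ U <;> simp [hL, hu, Fin.ext_iff]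
  · have h := SimpleGraph.card_filter_rep_ne_le hrep
    have h2 : (Finset.univ.filter fun u => u ∈ U ∨ rep u ≠ u).card =
        ((Finset.range n).filter fun u => L u ≠ u + 1).card := by
      rw [Finset.card_filter, Finset.card_filter,
        ← Fin.sum_univ_eq_sum_range (fun u => if L u ≠ u + 1 then 1 else 0)]
      refine Finset.sum_congr rfl fun u _ => if_congr ?_ rfl rfl
      by_cases hu : u ∈ U <;> simp [hL, hu, Fin.ext_iff]
    rw [← h2]
    refine h.trans ?_
    have : matchingNumber (streamGraph n σ) = maxMatching n σ := rfl
    omega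

/-- The words of the help message with the `m` matching edges enumerated by `e`, the `q` labels
enumerated by `f`, and the `d` coefficients `g`. -/
def helpWord (m q d : ℕ) (e f g : ℕ → ℕ) (j : ℕ) : ℕ :=
  if j = 0 then m else if j = 1 then q else if j < 2 + 2 * m then e (j - 2)
  else if j < 2 + 2 * m + 2 * q then f (j - (2 + 2 * m))
  else if j < 2 + 2 * m + 2 * q + d then g (j - (2 + 2 * m + 2 * q)) else 0

section HelpWord

variable {m q d : ℕ} {e f g : ℕ → ℕ}

theorem helpWord_edge {j : ℕ} (hj : j < 2 * m) : helpWord m q d e f g (2 + j) = e j := by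
  unfold helpWord
  rw [if_neg (by omega), if_neg (by omega), if_pos (by omega), Nat.add_sub_cancel_left]

theorem helpWord_label {j : ℕ} (hj : j < 2 * q) : helpWord m q d e f g (2 + 2 * m + j) = f j := by
  unfold helpWord
  rw [if_neg (by omega), if_neg (by omega), if_neg (by omega), if_pos (by omega),
    Nat.add_sub_cancel_left]

theorem helpWord_coeff {j : ℕ} (hj : j < d) :
    helpWord m q d e f g (2 + 2 * m + 2 * q + j) = g j := by
  unfold helpWord
  rw [if_neg (by omega), if_neg (by omega), if_neg (by omega), if_neg (by omega),
    if_pos (by omega), Nat.add_sub_cancel_left]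

theorem helpWord_eq_zero {j : ℕ} (hj : 2 + 2 * m + 2 * q + d ≤ j) :
    helpWord m q d e f g j = 0 := by
  unfold helpWord
  rw [if_neg (by omega), if_neg (by omega), if_neg (by omega), if_neg (by omega),
    if_neg (by omega)]

theorem helpWord_lt {B : ℕ} (hm : m < B) (hq : q < B) (he : ∀ j < 2 * m, e j < B)
    (hf : ∀ j < 2 * q, f j < B) (hg : ∀ j < d, g j < B) (j : ℕ) :
    helpWord m q d e f g j < B := by
  unfold helpWord
  split_ifs
  · exact hm
  · exact hq
  · exact he _ (by omega)
  · exact hf _ (by omega)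
  · exact hg _ (by omega)
  · omega

end HelpWord

theorem checkPoly_congr {n v p : ℕ} {c c' : ℕ → ℕ → ℕ} (h : ∀ a < n, ∀ b < n, c a b = c' a b)
    (σ : List Token) : checkPoly n v p c σ = checkPoly n v p c' σ :=
  Finset.sum_congr rfl fun a ha => Finset.sum_congr rfl fun b hb => by
    rw [h a (Finset.mem_range.1 ha) b (Finset.mem_range.1 hb)]

theorem two_mul_maxMatching_le (n : ℕ) (σ : List Token) : 2 * maxMatching n σ ≤ n := by
  obtain ⟨M, hM, hcard⟩ := SimpleGraph.exists_isMatching_ncard_eq (G := streamGraph n σ)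
  have h1 := hM.ncard_verts
  have h2 := Set.ncard_le_card M.verts
  rw [Nat.card_eq_fintype_card, Fintype.card_fin] at h2
  rw [maxMatching, ← hcard]
  omega

theorem exists_help {n v p : ℕ} {σ : List Token} (hσ : σ ∈ graphStreams n)
    (hp : n ^ 2 * (2 * n + 1) + n < p) {B : ℕ} (hpB : p ≤ B) (hnB : n + 1 < B) :
    ∃ (K : ℕ → ℕ) (N : ℕ), (∀ j, K j < B) ∧ (∀ j, N ≤ j → K j = 0) ∧
      N ≤ 2 + 6 * maxMatching n σ + 2 * rows n v ∧ StaticChecks n v K ∧ K 0 = maxMatching n σ ∧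
      helpPoly n v p K = checkPoly n v p (weight n K) σ := by
  have : NeZero p := ⟨by omega⟩
  have hval : ValidTokens n σ := hσ.1
  set m := maxMatching n σ with hm
  have hmn : 2 * m ≤ n := two_mul_maxMatching_le n σ
  obtain ⟨e, he, heinj, heM⟩ := exists_enum_maxMatching n σ
  rw [← hm] at he heinj heM
  obtain ⟨L, hLn, hcross, hbound, hQ⟩ := exists_label n σ
  set Q := (Finset.range n).filter fun u => L u ≠ u + 1 with hQdef
  obtain ⟨x, hxQ, hxsum⟩ := Q.exists_enum
  have hxn : ∀ i < Q.card, x i < n := fun i hi =>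
    Finset.mem_range.1 (Finset.mem_filter.1 (hxQ i hi)).1
  let f : ℕ → ℕ := fun j => if j % 2 = 0 then x (j / 2) else L (x (j / 2)) + 1
  let K : (ℕ → ℕ) → ℕ → ℕ := fun g => helpWord m Q.card (2 * rows n v) e f g
  have hK0 : ∀ g, K g 0 = m := fun g => rfl
  have hK1 : ∀ g, K g 1 = Q.card := fun g => rfl
  have hKe : ∀ g, ∀ i < m, K g (2 + 2 * i) = e (2 * i) := fun g i hi => helpWord_edge (by omega)
  have hKe' : ∀ g, ∀ i < m, K g (3 + 2 * i) = e (2 * i + 1) := fun g i hi => by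
    rw [show 3 + 2 * i = 2 + (2 * i + 1) by omega]
    exact helpWord_edge (by omega)
  have hlab : ∀ g, ∀ u < n, label n (K g) u = L u := by
    intro g u hu
    have h1 : listedLabel (K g) u = if u ∈ Q then L u + 1 else 0 := by
      unfold listedLabel
      rw [hK0, hK1]
      have h2 : ∀ i ∈ Finset.range Q.card, (if K g (2 + 2 * m + 2 * i) = u then
          K g (3 + 2 * m + 2 * i) else 0) = if x i = u then L (x i) + 1 else 0 := by
        intro i hi
        have hi := Finset.mem_range.1 hi
        have h3 : K g (2 + 2 * m + 2 * i) = x i := by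
          refine (helpWord_label (by omega)).trans ?_
          simp [f]
        have h4 : K g (3 + 2 * m + 2 * i) = L (x i) + 1 := by
          rw [show 3 + 2 * m + 2 * i = 2 + 2 * m + (2 * i + 1) by omega]
          refine (helpWord_label (by omega)).trans ?_
          simp only [f]
          rw [if_neg (by omega), show (2 * i + 1) / 2 = i by omega]
        rw [h3, h4]
      rw [Finset.sum_congr rfl h2, hxsum fun w => if w = u then L w + 1 else 0,
        Finset.sum_ite_eq']
    unfold label
    rw [h1]
    by_cases hu' : u ∈ Q
    · rw [if_pos hu', if_neg (by omega), Nat.add_sub_cancel,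
        Nat.mod_eq_of_lt (Nat.lt_succ_of_le (hLn u hu))]
    · rw [if_neg hu', if_pos rfl]
      by_contra h
      exact hu' (Finset.mem_filter.2 ⟨Finset.mem_range.2 hu, fun h' => h h'.symm⟩)
  have hw : ∀ g, ∀ a < n, ∀ b < n, weight n (K g) a b = weight n (K fun _ => 0) a b := by
    intro g a ha b hb
    unfold weight
    rw [hlab g a ha, hlab g b hb, hlab _ a ha, hlab _ b hb]
    congr 1
    unfold edgeCount
    rw [hK0, hK0]
    refine Finset.sum_congr rfl fun i hi => ?_
    have hi := Finset.mem_range.1 hi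
    rw [hKe _ i hi, hKe' _ i hi, hKe _ i hi, hKe' _ i hi]
  set P := checkPoly n v p (weight n (K fun _ => 0)) σ with hP
  set g : ℕ → ℕ := fun j => (P.coeff j).val with hg
  have hrows := rows_pos (n := n) (v := v)
  have hcoeff : ∀ j < 2 * rows n v, coeffWord (K g) j = g j := fun j hj => by
    unfold coeffWord
    rw [hK0, hK1]
    exact helpWord_coeff hj
  have hPg : checkPoly n v p (weight n (K g)) σ = P := checkPoly_congr (hw g) σ
  have hTot : weightedSum (weight n (K g)) σ = m := by
    have h1 := two_mul_weightedSum_weight (n := n) (H := K g) hval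
      (fun i hi => by rw [hKe g i hi]; exact he _ (by rw [hK0] at hi; omega))
      (fun i hi => by rw [hKe' g i hi]; exact he _ (by rw [hK0] at hi; omega))
      (fun i hi h => by
        rw [hKe g i hi, hKe' g i hi] at h
        rw [hK0] at hi
        have := heinj _ (by omega) _ (by omega) h
        omega)
    rw [hK0, Finset.sum_congr rfl fun i hi => by
        rw [hKe g i (Finset.mem_range.1 hi), hKe' g i (Finset.mem_range.1 hi),
          heM i (Finset.mem_range.1 hi)],
      Finset.sum_eq_zero fun a ha => Finset.sum_eq_zero fun b hb => ?_] at h1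
    · simp only [Finset.sum_const, Finset.card_range, nsmul_eq_mul] at h1
      linarith
    · have ha := Finset.mem_range.1 ha
      have hb := Finset.mem_range.1 hb
      rw [hlab g a ha, hlab g b hb]
      split_ifs with h
      · rcases eq_or_ne a b with rfl | hab
        · exact absurd rfl h.2
        · rcases hσ.2 a ha b hb hab with h2 | h2
          · rw [h2]; simp
          · exact absurd (hcross a ha b hb hab h2 h.1.1 h.1.2) h.2
      · simp
  refine ⟨K g, 2 + 2 * m + 2 * Q.card + 2 * rows n v, ?_, fun j hj => helpWord_eq_zero hj, by omega,
    ⟨⟨⟨?_, ?_⟩, ?_⟩, ?_, ?_⟩, rfl, ?_⟩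
  · refine helpWord_lt (by omega) (by omega) (fun j hj => (he j hj).trans (by omega))
      (fun j hj => ?_) (fun j _ => (ZMod.val_lt _).trans_le hpB)
    have := hxn (j / 2) (by omega)
    have := hLn _ this
    simp only [f]
    split_ifs <;> omega
  · rw [hK0]; exact hmn
  · refine Finset.sum_eq_zero fun j hj => ?_
    rw [hK0] at hj
    have hj := Finset.mem_range.1 hj
    rw [if_pos]
    exact (helpWord_edge hj).trans_lt (he j hj)
  · refine Finset.sum_eq_zero fun u _ => ?_
    rw [if_pos]
    unfold endpointCount
    rw [hK0, ← Finset.card_filter, Finset.card_le_one]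
    intro j hj k hk
    simp only [Finset.mem_filter, Finset.mem_range] at hj hk
    refine heinj j hj.1 k hk.1 ?_
    rw [← helpWord_edge (q := Q.card) (d := 2 * rows n v) (e := e) (f := f) (g := g) hj.1,
      ← helpWord_edge (q := Q.card) (d := 2 * rows n v) (e := e) (f := f) (g := g) hk.1]
    exact hj.2.trans hk.2.symm
  · rw [hK0, hm, ← hbound]
    have h (u) (hu : u ∈ Finset.range n) := hlab g u (Finset.mem_range.1 hu)
    unfold labelBound
    congr 1
    · exact Finset.sum_congr rfl fun u hu => by rw [h u hu]
    · refine Finset.sum_congr rfl fun l _ => ?_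
      rw [Finset.sum_congr rfl fun u hu => by rw [h u hu]]
  · rw [hcoeff _ (by omega), hg, hK0]
    beta_reduce
    rw [← hPg, coeff_checkPoly _ hval, hTot, Int.cast_natCast, ZMod.val_natCast,
      Nat.mod_eq_of_lt (by omega)]
  · rw [hPg]
    ext j
    rcases lt_or_ge j (2 * rows n v) with hj | hj
    · rw [coeff_helpPoly _ hj, hcoeff j hj, hg]
      simp
    · rw [coeff_eq_zero_of_natDegree_lt ((natDegree_helpPoly_lt _).trans_le hj),
        coeff_eq_zero_of_natDegree_lt]
      have h : P.natDegree ≤ 2 * (rows n v - 1) := natDegree_checkPoly_le _ hval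
      omega

/-! ### The scheme -/

variable {ι : Type} [Primcodable ι] {n v : ι → ℕ} {hn : Primrec n} {hv : Primrec v}

theorem rows_le (n v h : ℕ) (hn : 1 ≤ n) (hhv : n ^ 2 ≤ h * v) : rows n v ≤ 2 * h := by
  have h1 : n * n / v ≤ h := Nat.div_le_of_le_mul (by rw [mul_comm v, ← sq]; exact hhv)
  have h2 : 0 < h := by
    rcases Nat.eq_zero_or_pos h with rfl | h2
    · simp at hhv; omega
    · exact h2
  unfold rows
  omega

theorem rows_le_add_one {n v : ℕ} (hnv : n ≤ v) : rows n v ≤ n + 1 := by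
  unfold rows
  exact Nat.succ_le_succ (Nat.div_le_of_le_mul (Nat.mul_le_mul_right n hnv))

theorem prob_le_third (i : ι) (hnv : n i ≤ v i) (hn1 : 1 ≤ n i) {σ : List Token}
    (hσ : σ ∈ graphStreams (n i)) (H : List Bool) :
    (verifier n v hn hv).prob i (fun R => (verifier n v hn hv).out i R σ H ≠
      some (maxMatching (n i) σ) ∧ (verifier n v hn hv).out i R σ H ≠ none) ≤ 1 / 3 := by
  classical
  have := Fact.mk (modulus_prime (n i))
  set K := bitWord (width (n i)) (H.take (helpWords (n i) * width (n i))) with hK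
  set p := modulus (n i)
  have hout := fun R => out_eq (hn := hn) (hv := hv) i R (by omega) σ H K fun j => rfl
  refine Verifier.prob_le_third _ _ fun S hS => ?_
  by_cases hgood : StaticChecks (n i) (v i) K ∧ K 0 ≠ maxMatching (n i) σ
  · obtain ⟨hst, hne⟩ := hgood
    have hsum : (coeffWord K (rows (n i) (v i) - 1) : ZMod p) ≠
        ((weightedSum (weight (n i) K) σ : ℤ) : ZMod p) := by
      rw [hst.2.2]
      exact fun h => hne (hst.eq_maxMatching hσ (lt_modulus _) h.symm)
    have hcard : S.card ≤ 2 * rows (n i) (v i) := by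
      rw [← Finset.card_image_of_injective S (bitWord_ofFn_injective (n i))]
      refine card_le_of_eval_eq hσ.1 hsum _ fun r hr => ?_
      obtain ⟨R, hR, rfl⟩ := Finset.mem_image.1 hr
      refine ⟨(bitWord_ofFn_lt _ R).trans (two_pow_coinCount_lt_modulus _), ?_⟩
      by_contra h
      refine (hS R hR).2 ?_
      rw [hout R, if_neg fun h' => h h'.2]
    have hrows := rows_le_add_one hnv
    have hpow := pow_le_two_pow_coinCount (n i)
    show 3 * S.card ≤ 2 ^ coinCount (n i)
    nlinarith [Nat.zero_le (n i ^ 2), Nat.zero_le (n i ^ 3)]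
  · rw [Finset.eq_empty_of_forall_notMem (s := S)]
    · simp
    · intro R hR
      obtain ⟨h1, h2⟩ := hS R hR
      rw [hout R] at h1 h2
      split_ifs at h1 h2 with h
      · exact hgood ⟨h.1, fun h' => h1 (by rw [h'])⟩
      · exact h2 rfl

theorem isScheme (i : ι) (h : ℕ) (hn1 : 1 ≤ n i) (hhv : n i ^ 2 ≤ h * v i) (hnv : n i ≤ v i)
    {hcost : List Token → ℝ} {vcost : ℝ}
    (hh : ∀ σ, (42 * (maxMatching (n i) σ + h) * (1 + Real.log (n i)) : ℝ) ≤ hcost σ)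
    (hvc : (98 * v i * (1 + Real.log (n i)) : ℝ) ≤ vcost) :
    (verifier n v hn hv).IsScheme i (graphStreams (n i)) (maxMatching (n i)) hcost vcost := by
  have hv0 : 0 < v i := by omega
  have hwidth := width_le hn1
  have hspace : ∀ k : ℕ, k ≤ (14 * v i) * width (n i) → (k : ℝ) ≤ vcost := by
    intro k hk
    refine le_trans ?_ hvc
    have hk' : (k : ℝ) ≤ ((14 * v i) * width (n i) : ℕ) := by exact_mod_cast hk
    refine hk'.trans ?_
    push_cast
    calc (14 * v i * width (n i) : ℝ) ≤ 14 * v i * (7 * (1 + Real.log (n i))) := by gcongr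
      _ = _ := by ring
  have hmem : ∀ σ R, ((verifier n v hn hv).memory i R σ).length = (1 + v i) * width (n i) := by
    intro σ R
    obtain ⟨W, hW, -⟩ := memory_eq (hn := hn) (hv := hv) i R hv0 σ
    rw [hW, length_packWords]
  refine ⟨hspace _ ?_, fun σ _ σ' _ R => hspace _ ?_, fun σ _ R H => hspace _ ?_, fun σ hσ => ?_,
    fun σ hσ H => prob_le_third i hnv hn1 hσ H⟩
  · show coinCount (n i) ≤ _
    have : coinCount (n i) ≤ width (n i) := Nat.le_succ _
    nlinarith
  · rw [hmem]
    exact Nat.mul_le_mul_right _ (by omega)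
  · rw [memoryHelp_eq i R hv0, List.length_append, hmem, List.length_take]
    refine (add_le_add_right (min_le_left _ _) _).trans ?_
    rw [← add_mul]
    exact Nat.mul_le_mul_right _ (by unfold helpWords; omega)
  · obtain ⟨K, N, hKB, hKN, hN, hst, hK0, hpoly⟩ := exists_help (v := v i) hσ (lt_modulus (n i))
      (modulus_le (n i)) (add_one_lt_two_pow_width (n i))
    have hNle : N ≤ helpWords (n i) := by
      have h1 := two_mul_maxMatching_le (n i) σ
      have h2 := rows_le_add_one hnv
      unfold helpWords
      omega
    refine ⟨packWords (width (n i)) N K, ?_, ?_⟩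
    · refine le_trans ?_ (hh σ)
      rw [length_packWords]
      have h1 := rows_le (n i) (v i) h hn1 hhv
      have h0 := rows_pos (n := n i) (v := v i)
      have h2 : N ≤ 6 * (maxMatching (n i) σ + h) := by omega
      have h3 : (N : ℝ) ≤ 6 * (maxMatching (n i) σ + h) := by exact_mod_cast h2
      push_cast
      calc (N * width (n i) : ℝ) ≤
          6 * (maxMatching (n i) σ + h) * (7 * (1 + Real.log (n i))) := by gcongr
        _ = _ := by ring
    · have hall : ∀ R, (verifier n v hn hv).out i R σ (packWords (width (n i)) N K) =
          some (maxMatching (n i) σ) := by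
        intro R
        rw [out_eq i R hv0 σ _ K, if_pos ⟨hst, by rw [hpoly]⟩, hK0]
        intro j
        rw [List.take_of_length_le (by rw [length_packWords]; exact Nat.mul_le_mul_right _ hNle)]
        exact bitWord_packWords hKB hKN j
      exact Verifier.prob_eq_one _ _ hall

end MatchingScheme

theorem mainTheorem5 :
    (∃ (A : Verifier (ℕ × ℕ × ℕ)) (C c : ℕ), ∀ n h v : ℕ, 1 ≤ n → n ^ 2 ≤ h * v → n ≤ v →
      A.IsScheme (n, h, v) (graphStreams n) (maxMatching n)
        (fun σ => soft C c n ((maxMatching n σ : ℝ) + h))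
        (soft C c n v)) ∧
    (∃ (A : Verifier (ℕ × ℕ)) (C c : ℕ), ∀ n k : ℕ, 1 ≤ k → k ≤ n →
      A.IsScheme (n, k) (graphStreams n) (maxMatching n)
        (fun σ => soft C c n (max (maxMatching n σ : ℝ) k))
        (soft C c n ((n : ℝ) ^ 2 / k))) := by
  constructor
  · refine ⟨MatchingScheme.verifier (fun x => x.1) (fun x => x.2.2) (by fun_prop) (by fun_prop),
      100, 1, fun n h v hn hhv hnv => ?_⟩
    have hlog : 0 ≤ Real.log n := Real.log_natCast_nonneg n
    refine MatchingScheme.isScheme (n := fun x : ℕ × ℕ × ℕ => x.1) (v := fun x => x.2.2) (n, h, v) h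
      hn hhv hnv (fun σ => ?_) ?_
    all_goals
      simp only [soft, pow_one]
      gcongr
      norm_num
  · refine ⟨MatchingScheme.verifier (fun x => x.1) (fun x => x.1 * x.1 / x.2 + 1) (by fun_prop)
      (by fun_prop), 200, 1, fun n k hk hkn => ?_⟩
    have hlog : 0 ≤ Real.log n := Real.log_natCast_nonneg n
    have hdiv : n ≤ n * n / k := (Nat.le_div_iff_mul_le hk).2 (Nat.mul_le_mul_left n hkn)
    have hk0 : (0 : ℝ) < k := by exact_mod_cast hk
    refine MatchingScheme.isScheme (n := fun x : ℕ × ℕ => x.1)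
      (v := fun x => x.1 * x.1 / x.2 + 1) (n, k) k (hk.trans hkn) ?_ (by simp only; omega)
      (fun σ => ?_) ?_
    · rw [sq]
      exact (Nat.lt_mul_div_succ (n * n) hk).le
    · have h1 := le_max_left (maxMatching n σ : ℝ) k
      have h2 := le_max_right (maxMatching n σ : ℝ) k
      simp only [soft, pow_one]
      refine mul_le_mul_of_nonneg_right ?_ (by positivity)
      push_cast
      linarith
    · have h1 : ((n * n / k : ℕ) : ℝ) ≤ (n : ℝ) ^ 2 / k := by
        refine Nat.cast_div_le.trans ?_
        push_cast
        rw [sq]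
      have h2 : (1 : ℝ) ≤ (n : ℝ) ^ 2 / k := by
        rw [le_div_iff₀ hk0, one_mul]
        have : k ≤ n ^ 2 := by nlinarith
        exact_mod_cast this
      simp only [soft, pow_one]
      refine mul_le_mul_of_nonneg_right ?_ (by positivity)
      push_cast at h1 ⊢
      linarith
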